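/- **Setting.** An instance of RPC1 is given by a finite weighted bipartite graph $H$ without isolated vertices. One side of $H$ consists of drivers, the other of passengers. An edge $(\eta,r)$ is a feasible match of driver $\eta$ with the single passenger $r$ (all vehicle capacities are $1$), and its weight $w(\eta,r)\in\mathbb Z$ is its profit, possibly negative. A matching $M$ is a set of edges no two of which share a vertex, and $w(M)=\sum_{e\in M}w(e)$. Given a profit target $c\in\mathbb R$, RPC1 asks for a matching $M$ in $H$ with $w(M)\ge c$ and $|M|$ maximum among all such matchings. The flow network $N$ has vertices $s$, $t$ and the vertices of $H$. Its edges, all of capacity $1$, are $(s,\eta)$ for each driver and $(r,t)$ for each passenger, with cost $0$, and $(\eta,r)$ with cost $w_N(\eta,r)=-w(\eta,r)$ for each edge of $H$. Put $n=|V(N)|$, $m=|E(N)|$, and let $n_{\min}$ be the smaller of the numbers of drivers and passengers of $H$. The cost of a flow $f$ is $c(f)=\sum_{e\in E(N),\,f(e)>0}w_N(e)$. **Algorithm ExactNF2.** 1. If $N$ has an edge of negative cost, compute $h(u)=\mathrm{dist}(s,u)$ for all $u$ with Bellman–Ford; otherwise let $h=0$. Let $\hat N$ be $N$ with the costs $\hat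 w(u,v)=w_N(u,v)+h(u)-h(v)$. 2. Start with node potentials $\pi=0$, reduced costs $w_\pi=\hat w$ and the empty flow $f_0$. For $y=1,\dots,n_{\min}$ run a single-source shortest path procedure $SSSP(s)$ on the residual network of $\hat N$ with respect to $f_{y-1}$, weighted by $w_\pi$. If $t$ is unreachable, stop. Otherwise set $\pi(u):=\pi(u)-\mathrm{dist}_{y-1}(s,u)$ for all $u$, and set $w_\pi(u,v):=\hat w(u,v)-\pi(u)+\pi(v)$ for the edges of $\hat N$ in the residual network, leaving the reduced costs of the other residual edges unchanged. Augment one unit of flow along the shortest $s$–$t$ path found, which gives $f_y$; each path edge is replaced in the residual network by its reverse, with the negated reduced cost. 3. Stop Step 2 early, keeping $f_y$, as soon as $c(f_{y+1})>c(f_y)$ and $c(f_{y+1})>-c$. When Step 2 has ended with the flow $f_y$ (because of the early stop, because the flow cannot be increased, or because $y=n_{\min}$): if $c(f_y)\le -c$, output the edges of $H$ that carry positive flow in $f_y$; otherwise report that there is no matching of weight at least $c$. Let $t(N)$ be the (maximum) time that the procedure used takes to compute $SSSP(s)$ on one of the residual networks of $\hat N$ in Step 2. Time is the number of unit-cost steps: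 array accesses, additions, comparisons, elementary list operations and loop iterations. **Theorem.** Use in Step 2 any procedure that correctly solves the single-source shortest path problem on finite directed graphs with non-negative integer weights (returning the distances and a tree of shortest paths). Dijkstra's algorithm is such a procedure. Then the following hold. 1. For every $c$, ExactNF2 finds a matching $M$ in $H$ with $w(M)\ge c$ and $|M|$ maximum among all such matchings, or concludes that there is no matching $M$ in $H$ with $w(M)\ge c$; the conclusion is correct. 2. If $H$ has at least one edge, ExactNF2 runs in time $O(nm+n_{\min}\cdot t(N))$, with an absolute constant. 3. Let $f_0,f_1,f_2,\dots$ be the flows found in Step 2 when it is run without the early stop. If $c(f_y)<c(f_{y+1})$, then $c(f_{y+1})\le c(f_z)$ for every flow $f_z$ found with $z>y+1$. -/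

import Mathlib

namespace RPC

/-! ### Step counting

Algorithms are written in a monad that carries the number of elementary steps executed.  The
elementary steps are those of a unit-cost random access machine: an access to one array cell, one
addition, subtraction, negation or comparison of numbers or vertex names, one list operation at the
head of a list, one iteration of a loop.  Arrays are functions and are used in a single-threaded way:
the old version of an array is never used again after it has been overwritten. -/

/-- A value together with the number of elementary steps used to compute it. -/
structure Timed (α : Type) where
  val : α
  steps : ℕ

namespace Timed

instance : Monad Timed where
  pure a := ⟨a, 0⟩
  bind x f := ⟨(f x.val).val, x.steps + (f x.val).steps⟩

/-- Spend `k` steps. -/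
def tick (k : ℕ) : Timed Unit := ⟨(), k⟩

/-- Allocate an array with `size` cells, all holding `x`; one step per cell. -/
def newArray {ι α : Type} (size : ℕ) (x : α) : Timed (ι → α) := ⟨fun _ => x, size⟩

/-- Read one cell. -/
def read {ι α : Type} (a : ι → α) (i : ι) : Timed α := ⟨a i, 1⟩

/-- Write one cell. -/
def write {ι α : Type} [DecidableEq ι] (a : ι → α) (i : ι) (x : α) : Timed (ι → α) :=
  ⟨Function.update a i x, 1⟩

/-- `for x in l do body`, threading the loop state; one step of overhead per iteration. -/
def forEach {α σ : Type} (l : List α) (init : σ) (body : σ → α → Timed σ) : Timed σ :=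
  match l with
  | [] => tick 1 >>= fun _ => pure init
  | x :: l => do
    tick 1
    let s ← body init x
    forEach l s body

/-- Execute `body` `k` times, threading the state; one step of overhead per iteration. -/
def repeatFor {σ : Type} (k : ℕ) (init : σ) (body : σ → Timed σ) : Timed σ :=
  match k with
  | 0 => tick 1 >>= fun _ => pure init
  | k + 1 => do
    tick 1
    let s ← body init
    repeatFor k s body

/-- Build the list of the results of `body` on the members of `l`. -/
def mapEach {α β : Type} (l : List α) (body : α → Timed β) : Timed (List β) :=
  match l with
  | [] => tick 1 >>= fun _ => pure []
  | x :: l => do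
    tick 2
    let y ← body x
    let ys ← mapEach l body
    pure (y :: ys)

end Timed

open Timed

/-! ### Edge-weighted directed graphs and paths -/

/-- A finite edge-weighted directed graph: vertices, directed edges, and edge weights (only the
weights of the members of `arcs` matter). -/
structure Network (V : Type) where
  verts : List V
  arcs : List (V × V)
  weight : V × V → ℤ

namespace Network

variable {V : Type}

/-- No vertex is listed twice and every edge joins two listed vertices. -/
def WellFormed (G : Network V) : Prop :=
  G.verts.Nodup ∧ ∀ e ∈ G.arcs, e.1 ∈ G.verts ∧ e.2 ∈ G.verts

/-- `p = (v₁, …, v_q)` is a path from `u = v₁` to `v = v_q`. -/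
def IsPath (G : Network V) (u v : V) (p : List V) : Prop :=
  p.head? = some u ∧ p.getLast? = some v ∧ p.IsChain (fun x y => (x, y) ∈ G.arcs)

/-- The distance (sum of the edge weights) of a path. -/
def pathWeight (G : Network V) : List V → ℤ
  | u :: v :: p => G.weight (u, v) + pathWeight G (v :: p)
  | _ => 0

/-- The cost of a flow: the sum of the weights of the edges with positive flow. -/
def flowCost (G : Network V) (f : V × V → ℤ) : ℤ :=
  ((G.arcs.filter (fun e => 0 < f e)).map G.weight).sum

end Network

/-! ### Single-source shortest paths -/

/-- Output of a single-source shortest path computation: distances (`⊤` for unreachable vertices)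
and predecessors. -/
structure SSSPResult (V : Type) where
  dist : V → WithTop ℤ
  pred : V → Option V

/-- The output is right: `dist v` is the least distance of a path from `s` to `v` (`⊤` if there is
no path), and the predecessors trace such a shortest path. -/
structure IsShortestPathTree {V : Type} (G : Network V) (s : V) (r : SSSPResult V) : Prop where
  le_pathWeight : ∀ v ∈ G.verts, ∀ p, G.IsPath s v p → r.dist v ≤ (G.pathWeight p : WithTop ℤ)
  attained : ∀ v ∈ G.verts, r.dist v ≠ ⊤ → ∃ p, G.IsPath s v p ∧ p.Nodup ∧
    r.dist v = (G.pathWeight p : WithTop ℤ) ∧ p.IsChain (fun x y => r.pred y = some x)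

/-- A step-counted procedure taking a network and a source. -/
abbrev SSSPProcedure (V : Type) := Network V → V → Timed (SSSPResult V)

/-- The procedure solves the single-source shortest path problem with non-negative weights. -/
def SolvesSSSP {V : Type} (sssp : SSSPProcedure V) : Prop :=
  ∀ (G : Network V) (s : V), G.WellFormed → s ∈ G.verts → (∀ e ∈ G.arcs, 0 ≤ G.weight e) →
    IsShortestPathTree G s (sssp G s).val

section Algorithms

variable {V : Type} [DecidableEq V]

/-- Adjacency lists (heads of the outgoing edges of each vertex). -/
def adjacency (G : Network V) : Timed (V → List V) := do
  let adj ← newArray G.verts.length []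
  forEach G.arcs adj (fun adj e => do
    let l ← read adj e.1
    tick 1
    write adj e.1 (e.2 :: l))

/-- Scan the vertices for an unfinished one of least tentative distance. -/
noncomputable def selectMin (verts : List V) (dist : V → WithTop ℤ) (done : V → Bool) : Timed (Option V) :=
  forEach verts none (fun best v => do
    let b ← read done v
    tick 1
    if b then pure best
    else match best with
      | none => pure (some v)
      | some u => do
        let dv ← read dist v
        let du ← read dist u
        tick 1
        if dv < du then pure (some v) else pure best)

/-- Main loop of Dijkstra's algorithm: finish the unfinished vertex of least tentative distance and
relax its outgoing edges. -/
noncomputable def dijkstraLoop (G : Network V) (adj : V → List V) :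
    ℕ → (V → Bool) → SSSPResult V → Timed (SSSPResult V)
  | 0, _, r => pure r
  | k + 1, done, r => do
    tick 1
    let best ← selectMin G.verts r.dist done
    match best with
    | none => pure r
    | some u => do
      let done ← write done u true
      let l ← read adj u
      let r ← forEach l r (fun r v => do
        let du ← read r.dist u
        let dv ← read r.dist v
        let w ← read G.weight (u, v)
        tick 2
        if du + (w : WithTop ℤ) < dv then do
          let dist ← write r.dist v (du + (w : WithTop ℤ))
          let pred ← write r.pred v (some u)
          pure ⟨dist, pred⟩
        else pure r)
      dijkstraLoop G adj k done r

/-- Dijkstra's algorithm (array version). -/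
noncomputable def dijkstra : SSSPProcedure V := fun G s => do
  let adj ← adjacency G
  let dist ← newArray G.verts.length ⊤
  let dist ← write dist s 0
  let pred ← newArray G.verts.length none
  let done ← newArray G.verts.length false
  dijkstraLoop G adj G.verts.length done ⟨dist, pred⟩

/-- The Bellman-Ford algorithm: `n - 1` rounds, each relaxing every edge. -/
noncomputable def bellmanFord (G : Network V) (s : V) : Timed (V → WithTop ℤ) := do
  let dist ← newArray G.verts.length ⊤
  let dist ← write dist s 0
  repeatFor (G.verts.length - 1) dist (fun dist =>
    forEach G.arcs dist (fun dist e => do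
      let du ← read dist e.1
      let dv ← read dist e.2
      let w ← read G.weight e
      tick 2
      if du + (w : WithTop ℤ) < dv then write dist e.2 (du + (w : WithTop ℤ)) else pure dist))

/-- Johnson's reweighting.  If `N` has an edge of negative weight, let `h u` be the distance from
`s` to `u` found by Bellman-Ford, otherwise `h = 0`.  Returns `h` and the network with the weights
`ŵ (u, v) = w (u, v) + h u - h v`. -/
noncomputable def johnson (N : Network V) (s : V) : Timed (Network V × (V → ℤ)) := do
  let negative ← forEach N.arcs false (fun b e => do
    let w ← read N.weight e
    tick 1
    pure (b || decide (w < 0)))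
  let h ← newArray N.verts.length 0
  let h ← if negative then do
      let dist ← bellmanFord N s
      forEach N.verts h (fun h u => do
        let d ← read dist u
        write h u (d.untopD 0))
    else pure h
  let w' ← newArray (N.verts.length * N.verts.length) 0
  let w' ← forEach N.arcs w' (fun w' e => do
    let w ← read N.weight e
    let hu ← read h e.1
    let hv ← read h e.2
    tick 2
    write w' e (w + hu - hv))
  pure (⟨N.verts, N.arcs, w'⟩, h)

/-! ### Successive shortest paths with node potentials -/

/-- Node potentials `π`, reduced costs `w_π` of the edges of the residual network, and the flow. -/
structure SSPState (V : Type) where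
  pot : V → ℤ
  redCost : V × V → ℤ
  flow : V × V → ℤ

/-- `π = 0`, `w_π = ŵ`, and the empty flow. -/
def initialState (Nhat : Network V) : Timed (SSPState V) := do
  let pot ← newArray Nhat.verts.length 0
  let redCost ← newArray (Nhat.verts.length * Nhat.verts.length) 0
  let redCost ← forEach Nhat.arcs redCost (fun rc e => do
    let w ← read Nhat.weight e
    write rc e w)
  let flow ← newArray (Nhat.verts.length * Nhat.verts.length) 0
  pure ⟨pot, redCost, flow⟩

/-- The residual network (unit capacities, flow values `0` and `1`): every edge without flow, and the
reverse of every edge with flow, weighted by the reduced costs. -/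
def residual (Nhat : Network V) (st : SSPState V) : Timed (Network V) := do
  let arcs ← mapEach Nhat.arcs (fun e => do
    let x ← read st.flow e
    tick 1
    pure (if x = 0 then e else e.swap))
  pure ⟨Nhat.verts, arcs, st.redCost⟩

/-- `π u := π u - dist u` for every vertex. -/
def updatePot (verts : List V) (dist : V → WithTop ℤ) (pot : V → ℤ) : Timed (V → ℤ) :=
  forEach verts pot (fun pot u => do
    let d ← read dist u
    let x ← read pot u
    tick 1
    write pot u (x - d.untopD 0))

/-- `w_π (u, v) := ŵ (u, v) - π u + π v` for every edge of `Nhat` that lies in the residual network;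
the reduced costs of the other edges are unchanged. -/
def updateRedCost (Nhat : Network V) (pot : V → ℤ) (flow redCost : V × V → ℤ) :
    Timed (V × V → ℤ) :=
  forEach Nhat.arcs redCost (fun rc e => do
    let x ← read flow e
    tick 1
    if x = 0 then do
      let w ← read Nhat.weight e
      let pu ← read pot e.1
      let pv ← read pot e.2
      tick 2
      write rc e (w - pu + pv)
    else pure rc)

/-- Augment one unit of flow along the path that the predecessors trace back from `v` to `s` (at most
`k` edges).  A residual edge `(u, v)` is the reverse of an edge of the network iff `(v, u)` carries
flow.  The reversed residual edge gets the negated reduced cost. -/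
def augment (s : V) (pred : V → Option V) : ℕ → V → SSPState V → Timed (SSPState V)
  | 0, _, st => pure st
  | k + 1, v, st => do
    tick 1
    if v = s then pure st
    else do
      let p ← read pred v
      match p with
      | none => pure st
      | some u => do
        let x ← read st.flow (v, u)
        tick 1
        let flow ← if x = 0 then write st.flow (u, v) 1 else write st.flow (v, u) 0
        let rc ← read st.redCost (u, v)
        tick 1
        let redCost ← write st.redCost (v, u) (-rc)
        augment s pred k u ⟨st.pot, redCost, flow⟩

/-- One iteration of Step 2, from the flow of value `y - 1` to the flow of value `y`; the result is
`none` if the residual network has no path from `s` to `t`. -/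
def nextFlow (sssp : SSSPProcedure V) (Nhat : Network V) (s t : V) (st : SSPState V) :
    Timed (Option (SSPState V)) := do
  let G ← residual Nhat st
  let r ← sssp G s
  let dt ← read r.dist t
  tick 1
  if dt = ⊤ then pure none
  else do
    let pot ← updatePot Nhat.verts r.dist st.pot
    let redCost ← updateRedCost Nhat pot st.flow st.redCost
    let st' ← augment s r.pred Nhat.verts.length t ⟨pot, redCost, st.flow⟩
    pure (some st')

/-- Computes the cost of a flow in the original network, as the sum of `ŵ (u, v) + h v - h u` over
the edges with positive flow. -/
def computeCost (Nhat : Network V) (h : V → ℤ) (flow : V × V → ℤ) : Timed ℤ :=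
  forEach Nhat.arcs 0 (fun total e => do
    let x ← read flow e
    tick 1
    if 0 < x then do
      let w ← read Nhat.weight e
      let hu ← read h e.1
      let hv ← read h e.2
      tick 3
      pure (total + (w + hv - hu))
    else pure total)

/-- Step 2 with its stopping conditions, run for at most `k` more iterations from the state `st`,
whose flow costs `cost`.  Stops when the flow value cannot be increased, or when the next flow is more
expensive than the current one and its cost exceeds `-c`.  Returns the last flow before the stop. -/
noncomputable def flowLoop (sssp : SSSPProcedure V) (Nhat : Network V) (h : V → ℤ) (s t : V) (c : ℝ) :
    ℕ → SSPState V → ℤ → Timed (V × V → ℤ)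
  | 0, st, _ => pure st.flow
  | k + 1, st, cost => do
    tick 1
    let next ← nextFlow sssp Nhat s t st
    match next with
    | none => pure st.flow
    | some st' => do
      let cost' ← computeCost Nhat h st'.flow
      tick 2
      if cost < cost' ∧ -c < (cost' : ℝ) then pure st.flow
      else flowLoop sssp Nhat h s t c k st' cost'

end Algorithms

/-! ### The problem -/

/-- An instance of the ridesharing problem in which every vehicle has capacity `1`: the list of the
feasible matches, each consisting of one driver and one passenger, and their integral profits.
The feasible matches are the edges of the weighted bipartite graph `H`; its vertices are the drivers
and passengers that occur in a feasible match (isolated vertices are removed). -/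
structure RPC1Instance (D R : Type) where
  feasible : List (D × R)
  nodup : feasible.Nodup
  profit : D × R → ℤ

/-- The vertices of the flow network. -/
inductive NVertex (D R : Type) where
  | source
  | sink
  | driver (d : D)
  | passenger (r : R)
  deriving DecidableEq

namespace RPC1Instance

variable {D R : Type} [DecidableEq D] [DecidableEq R]

/-- A matching of `H`: a set of edges no two of which have a common vertex. -/
def IsMatching (I : RPC1Instance D R) (M : Finset (D × R)) : Prop :=
  (∀ e ∈ M, e ∈ I.feasible) ∧ ∀ e ∈ M, ∀ e' ∈ M, e ≠ e' → e.1 ≠ e'.1 ∧ e.2 ≠ e'.2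

/-- The weight `w(M)`. -/
def totalProfit (I : RPC1Instance D R) (M : Finset (D × R)) : ℤ := ∑ e ∈ M, I.profit e

/-- `M` is a matching of `H` with `w(M) ≥ c` and `|M|` maximum subject to this. -/
def IsSolution (I : RPC1Instance D R) (c : ℝ) (M : Finset (D × R)) : Prop :=
  I.IsMatching M ∧ c ≤ (I.totalProfit M : ℝ) ∧
    ∀ M' : Finset (D × R), I.IsMatching M' → c ≤ (I.totalProfit M' : ℝ) → M'.card ≤ M.card

/-- The drivers among the vertices of `H`. -/
def drivers (I : RPC1Instance D R) : List D := (I.feasible.map Prod.fst).dedup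

/-- The passengers among the vertices of `H`. -/
def passengers (I : RPC1Instance D R) : List R := (I.feasible.map Prod.snd).dedup

/-- The minimum of the numbers of drivers and of passengers of `H`. -/
def nMin (I : RPC1Instance D R) : ℕ := min I.drivers.length I.passengers.length

/-- The flow network `N`: edges from the source to the drivers and from the passengers to the sink
of cost `0`, and an edge of cost `-w(d, r)` for every edge `(d, r)` of `H`; all capacities are `1`. -/
def network (I : RPC1Instance D R) : Network (NVertex D R) where
  verts := .source :: .sink :: (I.drivers.map .driver ++ I.passengers.map .passenger)
  arcs := I.drivers.map (fun d => (.source, .driver d)) ++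
    I.feasible.map (fun e => (.driver e.1, .passenger e.2)) ++
    I.passengers.map (fun r => (.passenger r, .sink))
  weight e := match e with
    | (.driver d, .passenger r) => -I.profit (d, r)
    | _ => 0

/-- Construction of `N` from `H`: one step per vertex, two per edge (the edge and its cost). -/
def constructNetwork (I : RPC1Instance D R) : Timed (Network (NVertex D R)) := do
  tick I.network.verts.length
  tick (2 * I.network.arcs.length)
  pure I.network

/-- `∪ {e ∈ E(H) | f(e) > 0}`. -/
def extractMatching (I : RPC1Instance D R) (flow : NVertex D R × NVertex D R → ℤ) :
    Timed (List (D × R)) :=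
  forEach I.feasible [] (fun M e => do
    let x ← read flow (.driver e.1, .passenger e.2)
    tick 2
    if 0 < x then pure (e :: M) else pure M)

/-- Algorithm ExactNF2, with `sssp` as the procedure that computes `SSSP(s)`: construct `N`, apply
Johnson's reweighting, successively compute `f₁, f₂, …` until a stopping condition holds, and output
the matching of the last flow if it costs at most `-c`; `none` stands for the conclusion that there is
no matching of profit at least `c`. -/
noncomputable def exactNF2 (I : RPC1Instance D R) (sssp : SSSPProcedure (NVertex D R)) (c : ℝ) :
    Timed (Option (List (D × R))) := do
  let N ← I.constructNetwork
  let (Nhat, h) ← johnson N .source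
  let st ← initialState Nhat
  let cost ← computeCost Nhat h st.flow
  tick (I.drivers.length + I.passengers.length + 1)
  let flow ← flowLoop sssp Nhat h .source .sink c I.nMin st cost
  let cost ← computeCost Nhat h flow
  tick 2
  if (cost : ℝ) ≤ -c then do
    let M ← I.extractMatching flow
    pure (some M)
  else pure none

/-- The reweighted network `N̂` of ExactNF2. -/
noncomputable def reweighted (I : RPC1Instance D R) : Network (NVertex D R) :=
  (johnson I.network .source).val.1

/-- The state of Step 2 of ExactNF2 after `y` iterations, when Step 2 is run without the early stop:
its flow is `f_y`, with `f₀` the empty flow; `none` if no flow of value `y` is found. -/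
noncomputable def stateAfter (I : RPC1Instance D R) (sssp : SSSPProcedure (NVertex D R)) :
    ℕ → Option (SSPState (NVertex D R))
  | 0 => some (initialState I.reweighted).val
  | y + 1 => (stateAfter I sssp y).bind
      (fun st => (nextFlow sssp I.reweighted .source .sink st).val)

/-- `f` is the flow `f_y` found in Step 2 of ExactNF2. -/
def IsFlowFound (I : RPC1Instance D R) (sssp : SSSPProcedure (NVertex D R)) (y : ℕ)
    (f : NVertex D R × NVertex D R → ℤ) : Prop :=
  ∃ st, I.stateAfter sssp y = some st ∧ st.flow = f

/-- `t(N)`: the maximum number of steps that `sssp` needs for `SSSP(s)` on one of the residual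
networks of `N̂` with respect to `f₀, …, f_{n_min - 1}` and the current reduced costs. -/
noncomputable def ssspTime (I : RPC1Instance D R) (sssp : SSSPProcedure (NVertex D R)) : ℕ :=
  (Finset.range I.nMin).sup (fun y => match I.stateAfter sssp y with
    | some st => (sssp (residual I.reweighted st).val .source).steps
    | none => 0)

end RPC1Instance

end RPC

/-! The proof rests on one certificate. An `IsOptimalState` carries node potentials under which
edges without flow have non-negative reduced cost and edges with flow have non-positive reduced
cost. By weak duality (`IsOptimalState.sum_le`), a unit-capacity flow of value `k` then costs at
least `c(f_y) + (k - y)·σ`, where `σ` is the potential difference between source and sink. For `k =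
y`, this says that `f_y` is a cheapest flow of its value; in general, `σ` is a subgradient of the
least cost as a function of the value (`exists_slope`). If `f_{y+1}` is dearer than `f_y`, the
subgradient at `y + 1` is positive, so no larger matching is cheaper than `f_{y+1}`
(`flowCost_le_of_increase`). This is the third claim, and it justifies the early stop. If the sink
is unreachable, the reachable vertices form a cut that bounds all matchings
(`card_le_of_nextFlow_eq_none`). Matchings and flows are exchanged by `exists_isUnitFlow` and
`IsUnitFlow.isMatching`.

The delicate point is that the algorithm never refreshes the reduced cost of a reversed edge. It
stays at the value `0` written during augmentation, although the true reduced cost of the reversal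
may have become positive, so a shortest path is computed for possibly wrong weights. The shape of
the network repairs this. The only residual edge entering a matched driver comes from its passenger
(`residual_inner`), so both are at the same distance and the true reduced cost of their edge stays
`0`. Edges with flow at the source or the sink may drift, but their reversals enter the source or
leave the sink, and no simple source-sink path uses them. Hence all edges of the path found are
tight for the new potentials (`IsOptimalState.nextFlow`), and augmenting along tight edges preserves
the certificate (`IsOptimalState.augment`).

Johnson's reweighting supplies the first certificate: the edges are listed in topological order, so
one Bellman-Ford round already yields labels that no edge violates. For the running time, `H` has an
edge and no isolated vertices, whence `n ≤ 2m` and every term other than the shortest path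
computations is charged to `nm`. -/

namespace RPC

/-! ### Values and step counts of the basic loops -/

namespace Timed

variable {α β σ : Type}

@[simp] theorem val_pure (a : α) : (pure a : Timed α).val = a := rfl

@[simp] theorem steps_pure (a : α) : (pure a : Timed α).steps = 0 := rfl

@[simp] theorem val_bind (x : Timed α) (f : α → Timed β) : (x >>= f).val = (f x.val).val := rfl

@[simp] theorem steps_bind (x : Timed α) (f : α → Timed β) :
    (x >>= f).steps = x.steps + (f x.val).steps := rfl

@[simp] theorem steps_tick (k : ℕ) : (tick k).steps = k := rfl

@[simp] theorem val_newArray {ι : Type} (k : ℕ) (x : α) :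
    (newArray k x : Timed (ι → α)).val = fun _ => x := rfl

@[simp] theorem val_read {ι : Type} (a : ι → α) (i : ι) : (read a i).val = a i := rfl

@[simp] theorem val_write {ι : Type} [DecidableEq ι] (a : ι → α) (i : ι) (x : α) :
    (write a i x).val = Function.update a i x := rfl

theorem val_ite (p : Prop) [Decidable p] (x y : Timed α) :
    (if p then x else y).val = if p then x.val else y.val := apply_ite _ _ _ _

@[simp] theorem val_forEach (l : List α) (init : σ) (body : σ → α → Timed σ) :
    (forEach l init body).val = l.foldl (fun s x => (body s x).val) init := by
  induction l generalizing init with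
  | nil => rfl
  | cons x l ih => simp [forEach, ih]

@[simp] theorem val_mapEach (l : List α) (body : α → Timed β) :
    (mapEach l body).val = l.map (fun x => (body x).val) := by
  induction l with
  | nil => rfl
  | cons x l ih => simp [mapEach, ih]

@[simp] theorem val_repeatFor (k : ℕ) (init : σ) (body : σ → Timed σ) :
    (repeatFor k init body).val = (fun s => (body s).val)^[k] init := by
  induction k generalizing init with
  | zero => rfl
  | succ k ih => simp [repeatFor, ih]

theorem steps_forEach_le {B : ℕ} (l : List α) (init : σ) (body : σ → α → Timed σ)
    (h : ∀ s x, (body s x).steps ≤ B) : (forEach l init body).steps ≤ (B + 1) * l.length + 1 := by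
  induction l generalizing init with
  | nil => simp [forEach]
  | cons x l ih =>
    have h1 := h init x
    have h2 := ih (body init x).val
    simp only [forEach, steps_bind, steps_tick, List.length_cons, Nat.mul_add]
    omega

theorem steps_mapEach_le {B : ℕ} (l : List α) (body : α → Timed β)
    (h : ∀ x, (body x).steps ≤ B) : (mapEach l body).steps ≤ (B + 2) * l.length + 1 := by
  induction l with
  | nil => simp [mapEach]
  | cons x l ih =>
    have h1 := h x
    simp only [mapEach, steps_bind, steps_tick, steps_pure, List.length_cons, Nat.mul_add]
    omega

theorem steps_repeatFor_le {B : ℕ} (k : ℕ) (init : σ) (body : σ → Timed σ)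
    (h : ∀ s, (body s).steps ≤ B) : (repeatFor k init body).steps ≤ (B + 1) * k + 1 := by
  induction k generalizing init with
  | zero => simp [repeatFor]
  | succ k ih =>
    have h1 := h init
    have h2 := ih (body init).val
    simp only [repeatFor, steps_bind, steps_tick, Nat.mul_add]
    omega

end Timed

open Timed

/-! ### Paths and lower bounds on their weights -/

namespace Network

variable {V : Type} {G : Network V} {s u v : V} {p : List V}

theorem IsPath.singleton (G : Network V) (s : V) : G.IsPath s s [s] := by
  simp [IsPath]

theorem IsPath.concat (hp : G.IsPath s u p) (h : (u, v) ∈ G.arcs) : G.IsPath s v (p ++ [v]) := by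
  obtain ⟨h1, h2, h3⟩ := hp
  refine ⟨?_, by simp, ?_⟩
  · cases p <;> simp_all
  · rw [List.isChain_append]
    refine ⟨h3, by simp, ?_⟩
    intro x hx y hy
    simp_all

theorem pathWeight_concat (hp : p.getLast? = some u) :
    G.pathWeight (p ++ [v]) = G.pathWeight p + G.weight (u, v) := by
  induction p with
  | nil => simp at hp
  | cons x p ih =>
    cases p with
    | nil => simp_all [pathWeight]
    | cons y p =>
      have := ih (by simpa using hp)
      simp only [List.cons_append, pathWeight] at this ⊢
      rw [this]; ring

/-- A function that no edge violates bounds the distances of all paths from below. -/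
theorem IsPath.le_add_pathWeight {d : V → WithTop ℤ}
    (hd : ∀ e ∈ G.arcs, d e.2 ≤ d e.1 + (G.weight e : WithTop ℤ)) (hp : G.IsPath s v p) :
    d v ≤ d s + (G.pathWeight p : WithTop ℤ) := by
  induction p generalizing s with
  | nil => simp [IsPath] at hp
  | cons x p ih =>
    obtain ⟨h1, h2, h3⟩ := hp
    obtain rfl : x = s := by simpa using h1
    cases p with
    | nil =>
      obtain rfl : x = v := by simpa using h2
      simp [pathWeight]
    | cons y p =>
      rw [List.isChain_cons_cons] at h3
      have h4 := ih (s := y) ⟨rfl, by simpa using h2, h3.2⟩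
      have h5 := hd _ h3.1
      simp only [pathWeight, WithTop.coe_add] at h4 ⊢
      rw [← add_assoc]
      exact h4.trans (by gcongr)

end Network

/-! ### Correctness of Dijkstra's algorithm -/

section Dijkstra

variable {V : Type} [DecidableEq V]

theorem mem_adjacency (G : Network V) (u v : V) : v ∈ (adjacency G).val u ↔ (u, v) ∈ G.arcs := by
  have key : ∀ (l : List (V × V)) (a : V → List V),
      v ∈ (l.foldl (fun (a : V → List V) e => Function.update a e.1 (e.2 :: a e.1)) a) u ↔
        v ∈ a u ∨ (u, v) ∈ l := by
    intro l
    induction l with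
    | nil => simp
    | cons e l ih =>
      intro a
      rw [List.foldl_cons, ih, List.mem_cons]
      by_cases h : u = e.1
      · subst h
        simp [Prod.ext_iff]
        tauto
      · simp [Prod.ext_iff, h]
  have := key G.arcs (fun _ => [])
  simpa [adjacency] using this

theorem selectMin_spec {V : Type} (verts : List V) (dist : V → WithTop ℤ) (done : V → Bool) :
    match (selectMin verts dist done).val with
    | none => ∀ v ∈ verts, done v = true
    | some u => u ∈ verts ∧ done u = false ∧ ∀ v ∈ verts, done v = false → dist u ≤ dist v := by
  let f : Option V → V → Option V := fun best v =>
    if done v then best else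
      match best with
      | none => some v
      | some u => if dist v < dist u then some v else some u
  have hf : (selectMin verts dist done).val = verts.foldl f none := by
    simp only [selectMin, val_forEach]
    congr 1
    funext best v
    cases best <;> simp [↓val_bind, ↓val_ite, f] <;> rfl
  have key : ∀ (l : List V) (best : Option V), (∀ u, best = some u → done u = false) →
      match l.foldl f best with
      | none => best = none ∧ ∀ v ∈ l, done v = true
      | some u => (u ∈ l ∨ best = some u) ∧ done u = false ∧
          (∀ v ∈ l, done v = false → dist u ≤ dist v) ∧ ∀ b, best = some b → dist u ≤ dist b := by
    intro l
    induction l with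
    | nil =>
      intro best hb
      cases best with
      | none => simp
      | some u => simpa using hb
    | cons x l ih =>
      intro best hb
      rw [List.foldl_cons]
      have h1 : ∀ u, f best x = some u → done u = false := by
        intro u hu
        simp only [f] at hu
        split_ifs at hu with hx
        · exact hb u hu
        · cases best with
          | none => simp_all
          | some b =>
            simp only at hu
            split_ifs at hu <;> simp_all
      have h2 := ih (f best x) h1
      cases h3 : l.foldl f (f best x) with
      | none =>
        rw [h3] at h2
        simp only at h2 ⊢
        obtain ⟨h4, h5⟩ := h2
        simp only [f] at h4
        split_ifs at h4 with hx
        · exact ⟨h4, by simpa [hx] using h5⟩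
        · cases best with
          | none => simp at h4
          | some b => simp only at h4; split_ifs at h4
      | some u =>
        rw [h3] at h2
        simp only at h2 ⊢
        obtain ⟨h4, h5, h6, h7⟩ := h2
        by_cases hx : done x = true
        · have h8 : f best x = best := by simp [f, hx]
          rw [h8] at h4 h7
          refine ⟨by rw [List.mem_cons]; tauto, h5, ?_, h7⟩
          intro v hv hdv
          rcases List.mem_cons.1 hv with rfl | hv
          · simp [hx] at hdv
          · exact h6 v hv hdv
        · cases best with
          | none =>
            have h8 : f none x = some x := by simp [f, hx]
            rw [h8] at h4 h7
            refine ⟨?_, h5, ?_, by simp⟩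
            · rw [List.mem_cons]
              rcases h4 with h4 | h4
              · tauto
              · left; left; simpa using h4.symm
            · intro v hv hdv
              rcases List.mem_cons.1 hv with rfl | hv
              · exact h7 _ rfl
              · exact h6 v hv hdv
          | some b =>
            by_cases hlt : dist x < dist b
            · have h8 : f (some b) x = some x := by simp [f, hx, hlt]
              rw [h8] at h4 h7
              refine ⟨?_, h5, ?_, ?_⟩
              · rw [List.mem_cons]
                rcases h4 with h4 | h4
                · tauto
                · left; left; simpa using h4.symm
              · intro v hv hdv
                rcases List.mem_cons.1 hv with rfl | hv
                · exact h7 _ rfl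
                · exact h6 v hv hdv
              · intro b' hb'
                obtain rfl : b = b' := by simpa using hb'
                exact (h7 _ rfl).trans hlt.le
            · have h8 : f (some b) x = some b := by simp [f, hx, hlt]
              rw [h8] at h4 h7
              refine ⟨by rw [List.mem_cons]; tauto, h5, ?_, h7⟩
              intro v hv hdv
              rcases List.mem_cons.1 hv with rfl | hv
              · exact (h7 _ rfl).trans (not_lt.1 hlt)
              · exact h6 v hv hdv
  have h := key verts none (by simp)
  rw [hf]
  cases h3 : verts.foldl f none with
  | none => rw [h3] at h; exact h.2
  | some u =>
    rw [h3] at h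
    simp only at h ⊢
    obtain ⟨h4, h5, h6, -⟩ := h
    exact ⟨by simpa using h4, h5, h6⟩

/-- Relaxation of the edge `(u, v)`. -/
noncomputable def relaxEdge (G : Network V) (u : V) (r : SSSPResult V) (v : V) : SSSPResult V :=
  if r.dist u + (G.weight (u, v) : WithTop ℤ) < r.dist v then
    ⟨Function.update r.dist v (r.dist u + (G.weight (u, v) : WithTop ℤ)),
      Function.update r.pred v (some u)⟩
  else r

theorem dijkstraLoop_succ (G : Network V) (adj : V → List V) (k : ℕ) (done : V → Bool)
    (r : SSSPResult V) : (dijkstraLoop G adj (k + 1) done r).val =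
      match (selectMin G.verts r.dist done).val with
      | none => r
      | some u => (dijkstraLoop G adj k (Function.update done u true)
          ((adj u).foldl (relaxEdge G u) r)).val := by
  rw [dijkstraLoop]
  simp only [val_bind]
  cases (selectMin G.verts r.dist done).val with
  | none => rfl
  | some u =>
    simp only [↓val_bind, ↓val_ite, val_write, val_read, val_forEach, val_pure]
    congr 1 with r v

/-- The finished vertices reach their final distances along paths of finished vertices. -/
structure TracedBy {V : Type} (G : Network V) (s : V) (done : V → Bool) (r : SSSPResult V) :
    Prop where
  source : r.dist s ≤ 0
  path : ∀ v, r.dist v ≠ ⊤ → ∃ p, G.IsPath s v p ∧ p.Nodup ∧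
    r.dist v = (G.pathWeight p : WithTop ℤ) ∧ p.IsChain (fun x y => r.pred y = some x) ∧
    ∀ x ∈ p, x ≠ v → done x = true

/-- The state while the edges out of the vertex `u` are relaxed. -/
structure RelaxInv {V : Type} (G : Network V) (s u : V) (done : V → Bool)
    (r : SSSPResult V) : Prop extends TracedBy G s done r where
  self : done u = true
  relaxed : ∀ e ∈ G.arcs, done e.1 = true → e.1 ≠ u →
    r.dist e.2 ≤ r.dist e.1 + (G.weight e : WithTop ℤ)
  done_le : ∀ x, done x = true → r.dist x ≤ r.dist u
  le_undone : ∀ x ∈ G.verts, done x = false → r.dist u ≤ r.dist x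

/-- With non-negative weights a relaxation out of `u` cannot improve a finished vertex, since those
are at most as far as `u`. So only labels of unfinished vertices change; these occur on traced paths
only as last vertices, and the paths to all other vertices survive. -/
theorem RelaxInv.relaxEdge {G : Network V} {s u v : V} {done : V → Bool} {r : SSSPResult V}
    (hw : ∀ e ∈ G.arcs, 0 ≤ G.weight e) (h : RelaxInv G s u done r)
    (huv : (u, v) ∈ G.arcs) :
    RelaxInv G s u done (relaxEdge G u r v) ∧
      (RPC.relaxEdge G u r v).dist u = r.dist u ∧
      (∀ x, (RPC.relaxEdge G u r v).dist x ≤ r.dist x) ∧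
      (RPC.relaxEdge G u r v).dist v ≤ r.dist u + (G.weight (u, v) : WithTop ℤ) := by
  by_cases hlt : r.dist u + (G.weight (u, v) : WithTop ℤ) < r.dist v
  swap
  · have : RPC.relaxEdge G u r v = r := by simp [RPC.relaxEdge, hlt]
    rw [this]
    exact ⟨h, rfl, fun _ => le_rfl, not_lt.1 hlt⟩
  have hw0 : (0 : WithTop ℤ) ≤ (G.weight (u, v) : WithTop ℤ) := by exact_mod_cast hw _ huv
  have hle : r.dist u ≤ r.dist u + (G.weight (u, v) : WithTop ℤ) := le_add_of_nonneg_right hw0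
  have hdv : done v = false := by
    by_contra hd
    have := h.done_le v (by simpa using hd)
    exact absurd (hle.trans_lt hlt) (not_lt.2 this)
  have huv' : u ≠ v := by rintro rfl; simp [h.self] at hdv
  have hne : ∀ x, done x = true → x ≠ v := by rintro x hx rfl; simp [hx] at hdv
  set r' : SSSPResult V := ⟨Function.update r.dist v (r.dist u + (G.weight (u, v) : WithTop ℤ)),
      Function.update r.pred v (some u)⟩ with hr'
  have hrr : RPC.relaxEdge G u r v = r' := by simp [RPC.relaxEdge, hlt, hr']
  have hdist : ∀ x, x ≠ v → r'.dist x = r.dist x := fun x hx => by simp [hr', hx]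
  have hdistv : r'.dist v = r.dist u + (G.weight (u, v) : WithTop ℤ) := by simp [hr']
  have hpred : ∀ x, x ≠ v → r'.pred x = r.pred x := fun x hx => by simp [hr', hx]
  have hpredv : r'.pred v = some u := by simp [hr']
  have hmono : ∀ x, r'.dist x ≤ r.dist x := by
    intro x
    by_cases hx : x = v
    · subst hx; rw [hdistv]; exact hlt.le
    · rw [hdist x hx]
  have hchain : ∀ (p : List V), v ∉ p → p.IsChain (fun x y => r.pred y = some x) →
      p.IsChain (fun x y => r'.pred y = some x) := by
    intro p hvp hp
    rw [List.isChain_iff_getElem] at hp ⊢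
    intro i hi
    rw [hpred _ (fun h => hvp (h ▸ List.getElem_mem _))]
    exact hp i hi
  rw [hrr]
  refine ⟨⟨⟨(hmono s).trans h.source, ?_⟩, h.self, ?_, ?_, ?_⟩, hdist u huv', hmono, hdistv.le⟩
  · intro x hx
    by_cases hxv : x = v
    · subst hxv
      -- A strict improvement is impossible from an infinite label, so `u` has a traced path, which
      -- is extended by the edge to `x`.
      have hu : r.dist u ≠ ⊤ := by
        intro hu; rw [hu] at hlt; simp at hlt
      obtain ⟨p, h1, h2, h3, h4, h5⟩ := h.path u hu
      have hdone : ∀ y ∈ p, done y = true := by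
        intro y hy
        by_cases hyu : y = u
        · rw [hyu]; exact h.self
        · exact h5 y hy hyu
      have hxp : x ∉ p := fun hxp => hne x (hdone x hxp) rfl
      refine ⟨p ++ [x], h1.concat huv, ?_, ?_, ?_, ?_⟩
      · rw [List.nodup_append]
        refine ⟨h2, by simp, ?_⟩
        intro a ha b hb
        obtain rfl : b = x := by simpa using hb
        rintro rfl
        exact hxp ha
      · rw [hdistv, h3, Network.pathWeight_concat h1.2.1, WithTop.coe_add]
      · rw [List.isChain_append]
        refine ⟨hchain p hxp h4, by simp, ?_⟩
        intro a ha b hb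
        rw [h1.2.1] at ha
        simp at ha hb
        subst ha hb
        exact hpredv
      · intro y hy hyx
        rw [List.mem_append] at hy
        rcases hy with hy | hy
        · exact hdone y hy
        · exact absurd (by simpa using hy) hyx
    · rw [hdist x hxv] at hx ⊢
      obtain ⟨p, h1, h2, h3, h4, h5⟩ := h.path x hx
      refine ⟨p, h1, h2, h3, hchain p ?_ h4, h5⟩
      intro hvp
      exact hne v (h5 v hvp (Ne.symm hxv)) rfl
  · intro e he h1 h2
    rw [hdist _ (hne _ h1)]
    exact (hmono _).trans (h.relaxed e he h1 h2)
  · intro x hx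
    rw [hdist _ (hne _ hx), hdist u huv']
    exact h.done_le x hx
  · intro x hx hx'
    rw [hdist u huv']
    by_cases hxv : x = v
    · subst hxv; rw [hdistv]; exact hle
    · rw [hdist x hxv]; exact h.le_undone x hx hx'

theorem RelaxInv.foldl {G : Network V} {s u : V} {done : V → Bool} {r : SSSPResult V}
    (hw : ∀ e ∈ G.arcs, 0 ≤ G.weight e) (h : RelaxInv G s u done r) (l : List V)
    (hl : ∀ v ∈ l, (u, v) ∈ G.arcs) :
    RelaxInv G s u done (l.foldl (RPC.relaxEdge G u) r) ∧
      (l.foldl (RPC.relaxEdge G u) r).dist u = r.dist u ∧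
      (∀ x, (l.foldl (RPC.relaxEdge G u) r).dist x ≤ r.dist x) ∧
      ∀ v ∈ l, (l.foldl (RPC.relaxEdge G u) r).dist v ≤
        r.dist u + (G.weight (u, v) : WithTop ℤ) := by
  induction l generalizing r with
  | nil => simp [h]
  | cons v l ih =>
    obtain ⟨h1, h2, h3, h4⟩ := h.relaxEdge hw (hl v (by simp))
    obtain ⟨h5, h6, h7, h8⟩ := ih h1 (fun x hx => hl x (by simp [hx]))
    rw [List.foldl_cons]
    refine ⟨h5, h6.trans h2, fun x => (h7 x).trans (h3 x), ?_⟩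
    intro x hx
    rcases List.mem_cons.1 hx with rfl | hx
    · exact (h7 _).trans h4
    · rw [← h2]; exact h8 x hx

/-- The state between two iterations of the main loop of Dijkstra's algorithm. -/
structure DijkstraInv {V : Type} (G : Network V) (s : V) (done : V → Bool)
    (r : SSSPResult V) : Prop extends TracedBy G s done r where
  relaxed : ∀ e ∈ G.arcs, done e.1 = true → r.dist e.2 ≤ r.dist e.1 + (G.weight e : WithTop ℤ)
  done_le : ∀ x, done x = true → ∀ y ∈ G.verts, done y = false → r.dist x ≤ r.dist y

theorem DijkstraInv.isShortestPathTree {V : Type} {G : Network V} {s : V} {done : V → Bool}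
    {r : SSSPResult V} (hG : G.WellFormed) (h : DijkstraInv G s done r)
    (hd : ∀ v ∈ G.verts, done v = true) : IsShortestPathTree G s r where
  le_pathWeight v _ p hp := by
    have h1 := hp.le_add_pathWeight (fun e he => h.relaxed e he (hd _ (hG.2 e he).1))
    exact h1.trans (by simpa using add_le_add_left h.source _)
  attained v _ hv := by
    obtain ⟨p, h1, h2, h3, h4, -⟩ := h.path v hv
    exact ⟨p, h1, h2, h3, h4⟩

/-- Each round finishes one vertex, so a counter that bounds the number of unfinished vertices never
runs out too early. Unreachable vertices are selected too; relaxing from distance `⊤` changes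
nothing. -/
theorem DijkstraInv.dijkstraLoop {G : Network V} {s : V} {done : V → Bool} {r : SSSPResult V}
    (hG : G.WellFormed) (hw : ∀ e ∈ G.arcs, 0 ≤ G.weight e) {adj : V → List V}
    (hadj : ∀ u v, v ∈ adj u ↔ (u, v) ∈ G.arcs) (k : ℕ) (h : DijkstraInv G s done r)
    (hk : (G.verts.filter (fun v => !done v)).length ≤ k) :
    IsShortestPathTree G s (dijkstraLoop G adj k done r).val := by
  induction k generalizing done r with
  | zero =>
    refine h.isShortestPathTree hG ?_
    simpa using hk
  | succ k ih =>
    rw [dijkstraLoop_succ]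
    have hs := selectMin_spec G.verts r.dist done
    cases hu : (selectMin G.verts r.dist done).val with
    | none =>
      rw [hu] at hs
      exact h.isShortestPathTree hG hs
    | some u =>
      rw [hu] at hs
      obtain ⟨hu1, hu2, hu3⟩ := hs
      have hdone : ∀ x, Function.update done u true x = true ↔ x = u ∨ done x = true := by
        intro x
        by_cases hx : x = u
        · simp [hx]
        · simp [hx]
      have hundone : ∀ x, Function.update done u true x = false ↔ x ≠ u ∧ done x = false := by
        intro x
        by_cases hx : x = u
        · simp [hx]
        · simp [hx]
      -- The minimality of `u` among the unfinished vertices places its label between those of the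
      -- finished and of the unfinished vertices.
      have hinv : RelaxInv G s u (Function.update done u true) r := by
        refine ⟨⟨h.source, ?_⟩, by simp, ?_, ?_, ?_⟩
        · intro v hv
          obtain ⟨p, h1, h2, h3, h4, h5⟩ := h.path v hv
          exact ⟨p, h1, h2, h3, h4, fun x hx hxv => (hdone x).2 (Or.inr (h5 x hx hxv))⟩
        · intro e he h1 h2
          exact h.relaxed e he (((hdone _).1 h1).resolve_left h2)
        · intro x hx
          rcases (hdone x).1 hx with rfl | hx
          · exact le_rfl
          · exact h.done_le x hx u hu1 hu2
        · intro x hx hx'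
          exact hu3 x hx ((hundone x).1 hx').2
      obtain ⟨h1, h2, h3, h4⟩ := hinv.foldl hw (adj u) (fun v hv => (hadj u v).1 hv)
      refine ih ⟨h1.toTracedBy, ?_, ?_⟩ ?_
      · intro e he hd
        by_cases heu : e.1 = u
        · rw [heu, h2]
          have := h4 e.2 ((hadj u e.2).2 (heu ▸ he))
          rwa [← heu] at this ⊢
        · exact h1.relaxed e he hd heu
      · intro x hx y hy hy'
        exact (h1.done_le x hx).trans (h1.le_undone y hy hy')
      · have hlt : (G.verts.filter (fun v => !(Function.update done u true) v)).length <
            (G.verts.filter (fun v => !done v)).length := by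
          have hsub : G.verts.filter (fun v => !(Function.update done u true) v) =
              (G.verts.filter (fun v => !done v)).filter (fun v => v ≠ u) := by
            rw [List.filter_filter]
            congr 1
            funext v
            by_cases hv : v = u <;> simp [hv]
          rw [hsub]
          refine List.length_filter_lt_length_iff_exists.2 ⟨u, ?_, by simp⟩
          simp [hu1, hu2]
        omega

theorem dijkstra_solvesSSSP : SolvesSSSP (dijkstra (V := V)) := by
  intro G s hG _ hw
  have h : DijkstraInv G s (fun _ => false)
      ⟨Function.update (fun _ => ⊤) s 0, fun _ => none⟩ := by
    refine ⟨⟨by simp, ?_⟩, by simp, by simp⟩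
    intro v hv
    obtain rfl : v = s := by
      by_contra hvs
      simp [hvs] at hv
    exact ⟨[v], Network.IsPath.singleton G v, by simp, by simp [Network.pathWeight], by simp,
      by simp⟩
  exact h.dijkstraLoop hG hw (mem_adjacency G) G.verts.length (List.length_filter_le _ _)

end Dijkstra

/-! ### Loops that fill arrays -/

section Arrays

variable {ι α : Type} [DecidableEq ι]

theorem foldl_update_ite (P : ι → Prop) [DecidablePred P] (g : ι → α) (l : List ι) (a : ι → α)
    (i : ι) :
    l.foldl (fun (a : ι → α) x => if P x then Function.update a x (g x) else a) a i =
      if i ∈ l ∧ P i then g i else a i := by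
  induction l generalizing a with
  | nil => simp
  | cons x l ih =>
    rw [List.foldl_cons, ih]
    by_cases hx : i = x
    · subst hx
      by_cases hP : P i <;> simp [hP]
    · by_cases hP : P x <;> simp [hP, hx]

theorem foldl_update (g : ι → α) (l : List ι) (a : ι → α) (i : ι) :
    l.foldl (fun (a : ι → α) x => Function.update a x (g x)) a i =
      if i ∈ l then g i else a i := by
  simpa using foldl_update_ite (fun _ => True) g l a i

/-- The new value depends on the old one, so unlike in `foldl_update` a repeated index would be
processed twice; hence `Nodup`. -/
theorem foldl_update_self (g : ι → α → α) {l : List ι} (hl : l.Nodup) (a : ι → α) (i : ι) :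
    l.foldl (fun (a : ι → α) x => Function.update a x (g x (a x))) a i =
      if i ∈ l then g i (a i) else a i := by
  induction l generalizing a with
  | nil => simp
  | cons x l ih =>
    rw [List.nodup_cons] at hl
    rw [List.foldl_cons, ih hl.2]
    by_cases hx : i = x
    · subst hx
      simp [hl.1]
    · simp [hx]

end Arrays

/-! ### Bellman-Ford on a topologically ordered edge list, and Johnson's reweighting -/

section BellmanFord

variable {V : Type} [DecidableEq V]

/-- One relaxation step of the Bellman-Ford algorithm. -/
noncomputable def relaxArc (w : V × V → ℤ) (d : V → WithTop ℤ) (e : V × V) : V → WithTop ℤ :=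
  if d e.1 + (w e : WithTop ℤ) < d e.2 then
    Function.update d e.2 (d e.1 + (w e : WithTop ℤ)) else d

theorem relaxArc_le (w : V × V → ℤ) (d : V → WithTop ℤ) (e : V × V) (v : V) :
    relaxArc w d e v ≤ d v := by
  unfold relaxArc
  split_ifs with h
  · by_cases hv : v = e.2
    · subst hv; simpa using h.le
    · simp [hv]
  · exact le_rfl

theorem relaxArc_of_ne (w : V × V → ℤ) (d : V → WithTop ℤ) {e : V × V} {v : V} (hv : v ≠ e.2) :
    relaxArc w d e v = d v := by
  unfold relaxArc
  split_ifs <;> simp [hv]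

theorem relaxArc_snd_le (w : V × V → ℤ) (d : V → WithTop ℤ) (e : V × V) :
    relaxArc w d e e.2 ≤ d e.1 + (w e : WithTop ℤ) := by
  unfold relaxArc
  split_ifs with h
  · simp
  · exact not_lt.1 h

theorem foldl_relaxArc_le (w : V × V → ℤ) (l : List (V × V)) (d : V → WithTop ℤ) (v : V) :
    l.foldl (relaxArc w) d v ≤ d v := by
  induction l generalizing d with
  | nil => exact le_rfl
  | cons e l ih => exact (ih _).trans (relaxArc_le w d e v)

theorem foldl_relaxArc_of_notMem (w : V × V → ℤ) (l : List (V × V)) (d : V → WithTop ℤ) {v : V}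
    (hv : ∀ e ∈ l, e.2 ≠ v) : l.foldl (relaxArc w) d v = d v := by
  induction l generalizing d with
  | nil => rfl
  | cons e l ih =>
    rw [List.foldl_cons, ih _ (fun e' he' => hv e' (by simp [he'])),
      relaxArc_of_ne w d (hv e (by simp)).symm]

/-- If the edges are listed in a topological order, one round of relaxations settles them all. -/
theorem foldl_relaxArc_relaxed (w : V × V → ℤ) {l : List (V × V)}
    (hl : l.Pairwise (fun e e' => e'.2 ≠ e.1)) (hne : ∀ e ∈ l, e.2 ≠ e.1) (d : V → WithTop ℤ) :
    ∀ e ∈ l, l.foldl (relaxArc w) d e.2 ≤ l.foldl (relaxArc w) d e.1 + (w e : WithTop ℤ) := by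
  induction l generalizing d with
  | nil => simp
  | cons x l ih =>
    rw [List.pairwise_cons] at hl
    intro e he
    rw [List.foldl_cons]
    rcases List.mem_cons.1 he with rfl | he
    -- No later edge ends at the tail of `e`, so the label there is final; the label at the head can
    -- only decrease further.
    · rw [foldl_relaxArc_of_notMem w l _ hl.1, relaxArc_of_ne w d (hne e (by simp)).symm]
      exact (foldl_relaxArc_le w l _ _).trans (relaxArc_snd_le w d e)
    · exact ih hl.2 (fun e he => hne e (by simp [he])) _ e he

theorem foldl_relaxArc_fixed (w : V × V → ℤ) {l : List (V × V)} {d : V → WithTop ℤ}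
    (hd : ∀ e ∈ l, d e.2 ≤ d e.1 + (w e : WithTop ℤ)) : l.foldl (relaxArc w) d = d := by
  induction l with
  | nil => rfl
  | cons x l ih =>
    rw [List.foldl_cons]
    have : relaxArc w d x = d := by
      unfold relaxArc
      rw [if_neg (not_lt.2 (hd x (by simp)))]
    rw [this]
    exact ih (fun e he => hd e (by simp [he]))

theorem val_bellmanFord (G : Network V) (s : V) : (bellmanFord G s).val =
    (fun d => G.arcs.foldl (relaxArc G.weight) d)^[G.verts.length - 1]
      (Function.update (fun _ => ⊤) s 0) := by
  simp only [bellmanFord, ↓val_bind, val_newArray, val_write, val_repeatFor, val_forEach]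
  congr 1
  funext d
  congr 1
  funext d e
  simp only [↓val_ite, val_read, val_write, val_pure]
  rfl

/-- The first round settles all edges and the remaining rounds fix its result. Two vertices are
required so that the `n - 1` rounds include at least one. That the labels are exact distances is
never needed. -/
theorem bellmanFord_relaxed {G : Network V} {s : V} (hn : 2 ≤ G.verts.length)
    (hl : G.arcs.Pairwise (fun e e' => e'.2 ≠ e.1)) (hne : ∀ e ∈ G.arcs, e.2 ≠ e.1) :
    (bellmanFord G s).val s ≠ ⊤ ∧ ∀ e ∈ G.arcs,
      (bellmanFord G s).val e.2 ≤ (bellmanFord G s).val e.1 + (G.weight e : WithTop ℤ) := by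
  obtain ⟨k, hk⟩ := Nat.exists_eq_add_of_le' hn
  have h1 := foldl_relaxArc_relaxed G.weight hl hne (Function.update (fun _ => ⊤) s 0)
  rw [val_bellmanFord, hk, show k + 2 - 1 = k + 1 from rfl, Function.iterate_succ_apply,
    Function.iterate_fixed (foldl_relaxArc_fixed G.weight h1)]
  refine ⟨?_, h1⟩
  have h2 := foldl_relaxArc_le G.weight G.arcs (Function.update (fun _ => ⊤) s 0) s
  simp only [Function.update_self] at h2
  exact ne_top_of_le_ne_top (by simp) h2

/-- The node potentials `h` of Johnson's reweighting. -/
noncomputable def johnsonPotential (N : Network V) (s : V) : V → ℤ := fun v =>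
  if N.arcs.any (fun e => N.weight e < 0) = true then
    if v ∈ N.verts then ((bellmanFord N s).val v).untopD 0 else 0
  else 0

theorem val_johnson (N : Network V) (s : V) : (johnson N s).val =
    (⟨N.verts, N.arcs, fun e => if e ∈ N.arcs then
      N.weight e + johnsonPotential N s e.1 - johnsonPotential N s e.2 else 0⟩,
      johnsonPotential N s) := by
  have hany : ∀ (l : List (V × V)) (b : Bool),
      l.foldl (fun b e => b || decide (N.weight e < 0)) b =
        (b || l.any (fun e => N.weight e < 0)) := by
    intro l
    induction l with
    | nil => simp
    | cons x l ih => intro b; rw [List.foldl_cons, ih, List.any_cons, Bool.or_assoc]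
  have hcond : (forEach N.arcs false (fun b e => do
      let w ← Timed.read N.weight e
      tick 1
      pure (b || decide (w < 0)))).val = N.arcs.any (fun e => N.weight e < 0) := by
    rw [val_forEach]
    exact (hany _ _).trans (Bool.false_or _)
  rw [johnson, val_bind, hcond]
  by_cases hb : N.arcs.any (fun e => N.weight e < 0) = true
  · have hp : johnsonPotential N s = N.verts.foldl (fun (h : V → ℤ) u =>
        Function.update h u (((bellmanFord N s).val u).untopD 0)) (fun _ => 0) := by
      funext v
      rw [foldl_update (fun u => ((bellmanFord N s).val u).untopD 0), johnsonPotential, if_pos hb]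
    simp only [↓val_bind, ↓val_ite, hb, if_true, val_pure, val_forEach, val_newArray, val_read,
      val_write]
    rw [← hp]
    congr 2
    funext e
    rw [foldl_update (fun e => N.weight e + johnsonPotential N s e.1 - johnsonPotential N s e.2)]
    split_ifs <;> rfl
  · have hp : johnsonPotential N s = (fun _ => 0) := by
      funext v
      rw [johnsonPotential, if_neg hb]
    simp only [↓val_bind, ↓val_ite, hb, val_pure, val_forEach, val_newArray, val_read,
      val_write, ← hp]
    simp only [Bool.false_eq_true, if_false]
    congr 2
    funext e
    rw [foldl_update (fun e => N.weight e + johnsonPotential N s e.1 - johnsonPotential N s e.2),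
      hp]
    split_ifs <;> rfl

/-- Non-negativity is exactly the statement that no edge violates the labels. `hreach` expresses
reachability from `s` through closed vertex sets; it is applied to the set of vertices with finite
label, so that the default value of `untopD` never enters. -/
theorem johnson_weight_nonneg {N : Network V} {s : V} (hn : 2 ≤ N.verts.length)
    (hN : ∀ e ∈ N.arcs, e.1 ∈ N.verts ∧ e.2 ∈ N.verts)
    (hl : N.arcs.Pairwise (fun e e' => e'.2 ≠ e.1)) (hne : ∀ e ∈ N.arcs, e.2 ≠ e.1)
    (hreach : ∀ S : V → Prop, S s → (∀ e ∈ N.arcs, S e.1 → S e.2) → ∀ v ∈ N.verts, S v) :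
    ∀ e ∈ N.arcs, 0 ≤ (johnson N s).val.1.weight e := by
  intro e he
  rw [val_johnson]
  simp only [he, if_true]
  obtain ⟨h6, h7⟩ := hN e he
  by_cases hb : N.arcs.any (fun e => N.weight e < 0) = true
  · obtain ⟨h2, h3⟩ := bellmanFord_relaxed (s := s) hn hl hne
    have h4 : ∀ v ∈ N.verts, (bellmanFord N s).val v ≠ ⊤ := by
      refine hreach _ h2 ?_
      intro e he h5
      refine ne_top_of_le_ne_top ?_ (h3 e he)
      simp [h5]
    have h5 := h3 e he
    simp only [johnsonPotential, hb, if_true, h6, h7]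
    lift (bellmanFord N s).val e.1 to ℤ using h4 _ h6 with a
    lift (bellmanFord N s).val e.2 to ℤ using h4 _ h7 with b
    simp only [WithTop.untopD_coe]
    have : b ≤ a + N.weight e := by exact_mod_cast h5
    omega
  · simp only [johnsonPotential, hb]
    simp only [List.any_eq_true, decide_eq_true_eq, not_exists, not_and, not_lt] at hb
    have := hb e he
    simpa using this

end BellmanFord

/-! ### Auxiliary facts on lists -/

section Lists

theorem sum_map_update_mul {ι : Type} [DecidableEq ι] {l : List ι} (hl : l.Nodup) (f g : ι → ℤ)
    {a : ι} (ha : a ∈ l) (x : ℤ) :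
    (l.map (fun e => Function.update f a x e * g e)).sum =
      (l.map (fun e => f e * g e)).sum + (x - f a) * g a := by
  induction l with
  | nil => simp at ha
  | cons b l ih =>
    rw [List.nodup_cons] at hl
    rw [List.map_cons, List.map_cons, List.sum_cons, List.sum_cons]
    by_cases hab : b = a
    · subst hab
      have : l.map (fun e => Function.update f b x e * g e) = l.map (fun e => f e * g e) := by
        refine List.map_congr_left fun e he => ?_
        rw [Function.update_of_ne]
        rintro rfl
        exact hl.1 he
      rw [this, Function.update_self]
      ring
    · have ha' : a ∈ l := by
        rcases List.mem_cons.1 ha with h | h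
        · exact absurd h.symm hab
        · exact h
      rw [ih hl.2 ha', Function.update_of_ne hab]
      ring

theorem exists_rel_getLast {α : Type} {R : α → α → Prop} {p : List α} {s v : α}
    (hp : p.IsChain R) (hs : p.head? = some s) (hv : p.getLast? = some v) (hne : s ≠ v) :
    ∃ x, R x v := by
  induction p generalizing s with
  | nil => simp at hs
  | cons a p ih =>
    cases p with
    | nil => simp_all
    | cons b p =>
      rw [List.isChain_cons_cons] at hp
      by_cases hb : b = v
      · subst hb; exact ⟨_, hp.1⟩
      · exact ih (s := b) hp.2 rfl (by simpa using hv) hb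

end Lists

/-! ### Residual networks, node potentials and augmentation -/

section Residual

variable {V : Type}

/-- If no edge violates `d`, then the distance of a path is at least the difference of the values of
`d` at its ends, and if they are equal, then all edges of the path are tight. -/
theorem Network.IsPath.isChain_tight {G : Network V} {d : V → ℤ}
    (hd : ∀ e ∈ G.arcs, d e.2 ≤ d e.1 + G.weight e) {u v : V} {p : List V} (hp : G.IsPath u v p) :
    d v ≤ d u + G.pathWeight p ∧ (d u + G.pathWeight p ≤ d v →
      p.IsChain (fun x y => (x, y) ∈ G.arcs ∧ d y = d x + G.weight (x, y))) := by
  induction p generalizing u with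
  | nil => simp [Network.IsPath] at hp
  | cons x p ih =>
    obtain ⟨h1, h2, h3⟩ := hp
    obtain rfl : x = u := by simpa using h1
    cases p with
    | nil =>
      obtain rfl : x = v := by simpa using h2
      simp [Network.pathWeight]
    | cons y p =>
      rw [List.isChain_cons_cons] at h3
      obtain ⟨h4, h6⟩ := ih (u := y) ⟨rfl, by simpa using h2, h3.2⟩
      have h5 := hd _ h3.1
      simp only [Network.pathWeight] at h4 h5 ⊢
      refine ⟨by omega, fun h7 => ?_⟩
      rw [List.isChain_cons_cons]
      exact ⟨⟨h3.1, by omega⟩, h6 (by omega)⟩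

/-- `f` is a flow of value `y`, stated through the potential differences that it runs across. -/
def IsFlow (N : Network V) (s t : V) (f : V × V → ℤ) (y : ℤ) : Prop :=
  ∀ p : V → ℤ, (N.arcs.map (fun e => f e * (p e.1 - p e.2))).sum = y * (p s - p t)

/-- The reduced cost of an edge with respect to node potentials. -/
def reducedCost (N : Network V) (π : V → ℤ) (e : V × V) : ℤ := N.weight e - π e.1 + π e.2

/-- A simple directed network without antiparallel edges. -/
structure IsSimpleNetwork (N : Network V) (s t : V) : Prop where
  wellFormed : N.WellFormed
  nodup : N.arcs.Nodup
  swap_notMem : ∀ e ∈ N.arcs, e.swap ∉ N.arcs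
  source_mem : s ∈ N.verts
  sink_mem : t ∈ N.verts
  source_ne_sink : s ≠ t

/-- A `0`-`1`-valued function on the edges with node potentials that prove it to be of least cost
(among the functions of the same excess), and with the reduced costs kept by the algorithm. -/
structure IsOptimalState (N : Network V) (s t : V) (st : SSPState V) : Prop where
  zero_or_one : ∀ e ∈ N.arcs, st.flow e = 0 ∨ st.flow e = 1
  support : ∀ e, e ∉ N.arcs → st.flow e = 0
  forward : ∀ e ∈ N.arcs, st.flow e = 0 →
    0 ≤ reducedCost N st.pot e ∧ st.redCost e = reducedCost N st.pot e
  backward : ∀ e ∈ N.arcs, st.flow e = 1 → reducedCost N st.pot e ≤ 0 ∧ st.redCost e.swap = 0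
  inner : ∀ e ∈ N.arcs, st.flow e = 1 → e.1 ≠ s → e.2 ≠ t → reducedCost N st.pot e = 0

variable [DecidableEq V]

theorem val_initialState (N : Network V) : (initialState N).val =
    ⟨fun _ => 0, fun e => if e ∈ N.arcs then N.weight e else 0, fun _ => 0⟩ := by
  simp only [initialState, ↓val_bind, val_forEach, val_newArray, val_pure, val_read, val_write]
  congr 1
  funext e
  rw [foldl_update N.weight]
  split_ifs <;> rfl

theorem val_residual {V : Type} (N : Network V) (st : SSPState V) : (residual N st).val =
    ⟨N.verts, N.arcs.map (fun e => if st.flow e = 0 then e else e.swap), st.redCost⟩ := by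
  simp only [residual, ↓val_bind, val_mapEach, val_pure, val_read]
  rfl

theorem mem_arcs_residual {V : Type} {N : Network V} {st : SSPState V} {x y : V} :
    (x, y) ∈ (residual N st).val.arcs ↔ ((x, y) ∈ N.arcs ∧ st.flow (x, y) = 0) ∨
      ((y, x) ∈ N.arcs ∧ st.flow (y, x) ≠ 0) := by
  simp only [val_residual, List.mem_map]
  constructor
  · rintro ⟨e, he, h⟩
    split_ifs at h with h0
    · subst h; exact Or.inl ⟨he, h0⟩
    · have : e = (y, x) := by rw [← Prod.swap_swap e, h]; rfl
      subst this
      exact Or.inr ⟨he, h0⟩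
  · rintro (⟨h1, h2⟩ | ⟨h1, h2⟩)
    · exact ⟨_, h1, by simp [h2]⟩
    · exact ⟨_, h1, by simp [h2]⟩

theorem val_updatePot {verts : List V} (h : verts.Nodup) (d : V → WithTop ℤ) (pot : V → ℤ) {v : V}
    (hv : v ∈ verts) : (updatePot verts d pot).val v = pot v - (d v).untopD 0 := by
  simp only [updatePot, ↓val_bind, val_forEach, val_read, val_write]
  rw [foldl_update_self (fun u x => x - (d u).untopD 0) h, if_pos hv]

theorem val_updateRedCost (N : Network V) (pot : V → ℤ) (flow rc : V × V → ℤ) (e : V × V) :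
    (updateRedCost N pot flow rc).val e =
      if e ∈ N.arcs ∧ flow e = 0 then reducedCost N pot e else rc e := by
  simp only [updateRedCost, ↓val_bind, val_forEach, ↓val_ite, val_read, val_write, val_pure]
  refine Eq.trans ((foldl_update_ite (fun e => flow e = 0) (reducedCost N pot) N.arcs rc e)) ?_
  split_ifs <;> rfl

theorem val_augment_source (s : V) (pred : V → Option V) (k : ℕ) (st : SSPState V) :
    (augment s pred k s st).val = st := by
  cases k with
  | zero => rfl
  | succ k => simp [augment]

theorem val_augment_succ {s u v : V} {pred : V → Option V} (k : ℕ) (st : SSPState V) (hv : v ≠ s)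
    (hp : pred v = some u) : (augment s pred (k + 1) v st).val =
      (augment s pred k u ⟨st.pot, Function.update st.redCost (v, u) (-st.redCost (u, v)),
        if st.flow (v, u) = 0 then Function.update st.flow (u, v) 1
          else Function.update st.flow (v, u) 0⟩).val := by
  by_cases h : st.flow (v, u) = 0
  · simp only [augment, ↓val_bind, ↓val_ite, if_neg hv, val_read, hp, val_write, h, if_true]
  · simp only [augment, ↓val_bind, ↓val_ite, if_neg hv, val_read, hp, val_write, h, if_false]

/-- The residual edge `(x, y)` has reduced cost zero. -/
def IsTight (N : Network V) (st : SSPState V) (x y : V) : Prop :=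
  st.redCost (x, y) = 0 ∧ (((x, y) ∈ N.arcs ∧ st.flow (x, y) = 0) ∨
    ((y, x) ∈ N.arcs ∧ st.flow (y, x) = 1 ∧ reducedCost N st.pot (y, x) = 0))

/-- Augmentation along a path of tight edges keeps the potentials optimal. -/
theorem IsOptimalState.augment {N : Network V} {s t : V} (hN : IsSimpleNetwork N s t)
    {pred : V → Option V} {k : ℕ} {q : List V} {v : V} {st : SSPState V} {b : (V → ℤ) → ℤ}
    (h : IsOptimalState N s t st)
    (hb : ∀ p, (N.arcs.map (fun e => st.flow e * (p e.1 - p e.2))).sum = b p - p s + p v)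
    (hq : (v :: q).IsChain (fun y x => pred y = some x ∧ IsTight N st x y))
    (hnd : (v :: q).Nodup) (hlast : (v :: q).getLast? = some s) (hk : q.length < k) :
    IsOptimalState N s t (augment s pred k v st).val ∧
      (∀ p, (N.arcs.map (fun e => (augment s pred k v st).val.flow e * (p e.1 - p e.2))).sum =
        b p) ∧ (augment s pred k v st).val.pot = st.pot := by
  -- The path is walked backwards from the sink. By `hb`, the current function has the excess
  -- prescribed by `b`, except that one unit still has to be brought from `s` to `v`; each step
  -- moves this defect to the predecessor of `v`.
  induction q generalizing k v st with
  | nil =>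
    obtain rfl : v = s := by simpa using hlast
    rw [val_augment_source]
    exact ⟨h, fun p => by rw [hb]; ring, rfl⟩
  | cons u q ih =>
    obtain ⟨k, rfl⟩ : ∃ l, k = l + 1 := ⟨k - 1, by omega⟩
    rw [List.isChain_cons_cons] at hq
    obtain ⟨⟨hpred, hrc, htight⟩, hq⟩ := hq
    rw [List.nodup_cons] at hnd
    obtain ⟨hvq, hnd⟩ := hnd
    have hlast' : (u :: q).getLast? = some s := by simpa using hlast
    have hvs : v ≠ s := by
      rintro rfl
      exact hvq (List.mem_of_getLast? hlast')
    have huv : u ≠ v := by rintro rfl; simp at hvq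
    rw [val_augment_succ k st hvs hpred]
    set st' : SSPState V := ⟨st.pot, Function.update st.redCost (v, u) (-st.redCost (u, v)),
        if st.flow (v, u) = 0 then Function.update st.flow (u, v) 1
          else Function.update st.flow (v, u) 0⟩ with hst'
    -- The path is simple, so its remaining edges avoid `v` and are unaffected by this step.
    have hother : ∀ x y, x ≠ v → y ≠ v →
        st'.flow (x, y) = st.flow (x, y) ∧ st'.redCost (x, y) = st.redCost (x, y) := by
      intro x y hx hy
      constructor
      · simp only [hst']
        split_ifs <;> simp [hx, hy]
      · simp [hst', hx]
    have hchain : (u :: q).IsChain (fun y x => pred y = some x ∧ IsTight N st' x y) := by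
      rw [List.isChain_iff_getElem] at hq ⊢
      intro i hi
      obtain ⟨h1, h2⟩ := hq i hi
      refine ⟨h1, ?_⟩
      have h3 : (u :: q)[i] ≠ v := fun h => hvq (h ▸ List.getElem_mem _)
      have h4 : (u :: q)[i + 1] ≠ v := fun h => hvq (h ▸ List.getElem_mem _)
      unfold IsTight at h2 ⊢
      rw [(hother _ _ h4 h3).1, (hother _ _ h4 h3).2, (hother _ _ h3 h4).1]
      exact h2
    have hrc' : st'.redCost (v, u) = 0 := by simp [hst', hrc]
    have hrc'' : ∀ e, e ≠ (v, u) → st'.redCost e = st.redCost e := by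
      intro e he; simp [hst', he]
    have hmain : IsOptimalState N s t st' ∧ ∀ p,
        (N.arcs.map (fun e => st'.flow e * (p e.1 - p e.2))).sum = b p - p s + p u := by
      -- The residual edge is either a network edge, which gains flow, or a reversal, whose original
      -- loses flow. An edge that loses flow must satisfy the conditions for empty edges again; this
      -- is why tightness of a reversal also demands that the true reduced cost vanish, not merely
      -- the stored one.
      rcases htight with ⟨harc, hf⟩ | ⟨harc, hf, hred⟩
      · have hvu : (v, u) ∉ N.arcs := hN.swap_notMem _ harc
        have hf0 := h.support _ hvu
        have hflow : st'.flow = Function.update st.flow (u, v) 1 := by simp [hst', hf0]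
        have hne : ∀ e ∈ N.arcs, e ≠ (v, u) := by rintro e he rfl; exact hvu he
        obtain ⟨h1, h2⟩ := h.forward _ harc hf
        have hred : reducedCost N st.pot (u, v) = 0 := h2.symm.trans hrc
        refine ⟨⟨?_, ?_, ?_, ?_, ?_⟩, ?_⟩
        · intro e he
          rw [hflow]
          by_cases hee : e = (u, v)
          · simp [hee]
          · simpa [hee] using h.zero_or_one e he
        · intro e he
          rw [hflow, Function.update_of_ne (by rintro rfl; exact he harc)]
          exact h.support e he
        · intro e he
          rw [hflow, hrc'' e (hne e he)]
          by_cases hee : e = (u, v)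
          · simp [hee]
          · rw [Function.update_of_ne hee]
            exact h.forward e he
        · intro e he
          rw [hflow]
          by_cases hee : e = (u, v)
          · subst hee
            intro _
            exact ⟨hred.le, hrc'⟩
          · rw [Function.update_of_ne hee, hrc'' e.swap]
            · exact h.backward e he
            · intro hs
              apply hee
              rw [← Prod.swap_swap e, hs]; rfl
        · intro e he
          rw [hflow]
          by_cases hee : e = (u, v)
          · subst hee
            intro _ _ _
            exact hred
          · rw [Function.update_of_ne hee]
            exact h.inner e he
        · intro p
          rw [hflow, sum_map_update_mul hN.nodup _ _ harc, hb, hf]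
          ring
      · have huv' : (u, v) ∉ N.arcs := hN.swap_notMem _ harc
        have hflow : st'.flow = Function.update st.flow (v, u) 0 := by simp [hst', hf]
        refine ⟨⟨?_, ?_, ?_, ?_, ?_⟩, ?_⟩
        · intro e he
          rw [hflow]
          by_cases hee : e = (v, u)
          · simp [hee]
          · simpa [hee] using h.zero_or_one e he
        · intro e he
          rw [hflow, Function.update_of_ne (by rintro rfl; exact he harc)]
          exact h.support e he
        · intro e he
          rw [hflow]
          by_cases hee : e = (v, u)
          · subst hee
            intro _
            exact ⟨hred.ge, by rw [hrc']; exact hred.symm⟩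
          · rw [Function.update_of_ne hee, hrc'' e hee]
            exact h.forward e he
        · intro e he
          rw [hflow]
          by_cases hee : e = (v, u)
          · simp [hee]
          · rw [Function.update_of_ne hee, hrc'' e.swap]
            · exact h.backward e he
            · intro hs
              apply huv'
              have : e = (u, v) := by rw [← Prod.swap_swap e, hs]; rfl
              exact this ▸ he
        · intro e he
          rw [hflow]
          by_cases hee : e = (v, u)
          · simp [hee]
          · rw [Function.update_of_ne hee]
            exact h.inner e he
        · intro p
          rw [hflow, sum_map_update_mul hN.nodup _ _ harc, hb, hf]
          ring
    exact ih hmain.1 hmain.2 hchain hnd hlast' (by simpa using hk)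

theorem nextFlow_eq_some {sssp : SSSPProcedure V} {N : Network V} {s t : V} {st st' : SSPState V}
    (h : (nextFlow sssp N s t st).val = some st') :
    (sssp (residual N st).val s).val.dist t ≠ ⊤ ∧
    st' = (augment s (sssp (residual N st).val s).val.pred N.verts.length t
      ⟨(updatePot N.verts (sssp (residual N st).val s).val.dist st.pot).val,
        (updateRedCost N (updatePot N.verts (sssp (residual N st).val s).val.dist st.pot).val
          st.flow st.redCost).val, st.flow⟩).val := by
  by_cases h1 : (sssp (residual N st).val s).val.dist t = ⊤
  · simp only [nextFlow, ↓val_bind, ↓val_ite, val_read, val_pure, h1, if_true] at h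
    exact absurd h (by simp)
  · simp only [nextFlow, ↓val_bind, ↓val_ite, val_read, val_pure, h1, if_false] at h
    exact ⟨h1, (Option.some.inj h).symm⟩

theorem nextFlow_eq_none {sssp : SSSPProcedure V} {N : Network V} {s t : V} {st : SSPState V}
    (h : (nextFlow sssp N s t st).val = none) :
    (sssp (residual N st).val s).val.dist t = ⊤ := by
  by_contra h1
  simp only [nextFlow, ↓val_bind, ↓val_ite, val_read, val_pure, h1, if_false] at h
  exact absurd h (by simp)

/-- These are the preconditions of `SolvesSSSP`. Reversed edges are harmless because their stored
weight is `0`. -/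
theorem IsOptimalState.residual_wellFormed {V : Type} {N : Network V} {s t : V} {st : SSPState V}
    (hN : IsSimpleNetwork N s t) (h : IsOptimalState N s t st) :
    (residual N st).val.WellFormed ∧
      ∀ e ∈ (residual N st).val.arcs, 0 ≤ (residual N st).val.weight e := by
  refine ⟨⟨hN.wellFormed.1, ?_⟩, ?_⟩
  · rintro ⟨x, y⟩ he
    rcases mem_arcs_residual.1 he with ⟨h1, -⟩ | ⟨h1, -⟩
    · exact hN.wellFormed.2 _ h1
    · exact (hN.wellFormed.2 _ h1).symm
  · rintro ⟨x, y⟩ he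
    change 0 ≤ st.redCost (x, y)
    rcases mem_arcs_residual.1 he with ⟨h1, h2⟩ | ⟨h1, h2⟩
    · obtain ⟨h3, h4⟩ := h.forward _ h1 h2
      rw [h4]; exact h3
    · exact (h.backward _ h1 ((h.zero_or_one _ h1).resolve_left h2)).2.ge

/-- A shortest path to the tail extends by the edge. The extension may repeat a vertex, which
`IsPath` permits. -/
theorem IsShortestPathTree.dist_le {V : Type} {G : Network V} {s : V} {r : SSSPResult V}
    (hr : IsShortestPathTree G s r) (hG : G.WellFormed) {e : V × V} (he : e ∈ G.arcs) :
    r.dist e.2 ≤ r.dist e.1 + (G.weight e : WithTop ℤ) := by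
  by_cases h : r.dist e.1 = ⊤
  · simp [h]
  · obtain ⟨p, h1, -, h3, -⟩ := hr.attained _ (hG.2 e he).1 h
    rw [h3, ← WithTop.coe_add]
    have := hr.le_pathWeight _ (hG.2 e he).2 _ (h1.concat he)
    rwa [Network.pathWeight_concat h1.2.1] at this

/-- One iteration of Step 2 preserves optimality and increases the flow value by one. -/
theorem IsOptimalState.nextFlow {sssp : SSSPProcedure V} (hsssp : SolvesSSSP sssp)
    {N : Network V} {s t : V} (hN : IsSimpleNetwork N s t) {st st' : SSPState V} {y : ℤ}
    (h : IsOptimalState N s t st) (hy : IsFlow N s t st.flow y)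
    (hreach : ∀ S : V → Prop, S s → S t → (∀ e ∈ (residual N st).val.arcs, S e.1 → S e.2) →
      ∀ v ∈ N.verts, S v)
    (hinner : ∀ e ∈ N.arcs, st.flow e = 1 → e.1 ≠ s → e.2 ≠ t →
      ∀ x, (x, e.1) ∈ (residual N st).val.arcs → x = e.2)
    (hnext : (nextFlow sssp N s t st).val = some st') :
    IsOptimalState N s t st' ∧ IsFlow N s t st'.flow (y + 1) := by
  obtain ⟨htop, rfl⟩ := nextFlow_eq_some hnext
  obtain ⟨hG, hGw⟩ := h.residual_wellFormed hN
  have hr := hsssp (residual N st).val s hG hN.source_mem hGw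
  set G := (residual N st).val with hGdef
  set r := (sssp G s).val with hrdef
  have hGverts : G.verts = N.verts := rfl
  have hGweight : ∀ e, G.weight e = st.redCost e := fun _ => rfl
  have hs0 : r.dist s ≤ 0 := by
    simpa [Network.pathWeight] using
      hr.le_pathWeight s hN.source_mem [s] (Network.IsPath.singleton G s)
  -- Since the sink is reachable, `hreach` makes every vertex reachable. So the default `0` in the
  -- potential update is never used on a vertex of the network.
  have hfin : ∀ v ∈ N.verts, r.dist v ≠ ⊤ := by
    refine hreach _ (ne_top_of_le_ne_top (by simp) hs0) htop ?_
    intro e he h1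
    refine ne_top_of_le_ne_top ?_ (hr.dist_le hG he)
    simp [h1]
  set d : V → ℤ := fun v => (r.dist v).untopD 0 with hd
  have hdist : ∀ v ∈ N.verts, r.dist v = (d v : WithTop ℤ) := by
    intro v hv
    simp only [hd]
    lift r.dist v to ℤ using hfin v hv with a
    simp
  have hds : d s ≤ 0 := by
    rw [hdist s hN.source_mem] at hs0
    exact_mod_cast hs0
  have hdle : ∀ e ∈ G.arcs, d e.2 ≤ d e.1 + G.weight e := by
    intro e he
    have := hr.dist_le hG he
    rw [hdist _ (hG.2 e he).1, hdist _ (hG.2 e he).2] at this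
    exact_mod_cast this
  have hpath : ∀ v ∈ N.verts, ∃ p, G.IsPath s v p ∧ p.Nodup ∧
      p.IsChain (fun x y => r.pred y = some x) ∧
      p.IsChain (fun x y => (x, y) ∈ G.arcs ∧ d y = d x + G.weight (x, y)) := by
    intro v hv
    obtain ⟨p, h1, h2, h3, h4⟩ := hr.attained v hv (hfin v hv)
    -- A path whose weight equals the distance leaves no slack, so each of its edges is tight for
    -- `d`; `d s ≤ 0` suffices here.
    refine ⟨p, h1, h2, h4, (h1.isChain_tight hdle).2 ?_⟩
    rw [hdist v hv] at h3
    have h5 : d v = G.pathWeight p := by exact_mod_cast h3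
    omega
  set pot := (updatePot N.verts r.dist st.pot).val with hpot
  have hpotv : ∀ v ∈ N.verts, pot v = st.pot v - d v := fun v hv =>
    val_updatePot hN.wellFormed.1 r.dist st.pot hv
  have hred : ∀ e ∈ N.arcs, reducedCost N pot e = reducedCost N st.pot e + d e.1 - d e.2 := by
    intro e he
    obtain ⟨h1, h2⟩ := hN.wellFormed.2 e he
    simp only [reducedCost, hpotv _ h1, hpotv _ h2]
    ring
  set rc := (updateRedCost N pot st.flow st.redCost).val with hrc
  have hrcv : ∀ e, rc e = if e ∈ N.arcs ∧ st.flow e = 0 then reducedCost N pot e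
      else st.redCost e := val_updateRedCost N pot st.flow st.redCost
  have hback : ∀ e ∈ N.arcs, st.flow e = 1 → e.swap ∈ G.arcs := by
    rintro ⟨x, y⟩ he h1
    exact mem_arcs_residual.2 (Or.inr ⟨he, by rw [h1]; decide⟩)
  have hopt : IsOptimalState N s t ⟨pot, rc, st.flow⟩ := by
    refine ⟨h.zero_or_one, h.support, ?_, ?_, ?_⟩
    · intro e he h0
      obtain ⟨h1, h2⟩ := h.forward e he h0
      have h3 := hdle e (mem_arcs_residual.2 (Or.inl ⟨he, h0⟩))
      rw [hGweight, h2] at h3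
      refine ⟨?_, ?_⟩
      · change 0 ≤ reducedCost N pot e
        rw [hred e he]; omega
      · change rc e = reducedCost N pot e
        rw [hrcv, if_pos ⟨he, h0⟩]
    · intro e he h1
      obtain ⟨h2, h3⟩ := h.backward e he h1
      -- The reversal has stored weight `0`, so `d e.1 ≤ d e.2`, and the true reduced cost of an
      -- edge with flow can only decrease.
      have h4 := hdle _ (hback e he h1)
      rw [hGweight, h3] at h4
      simp only [Prod.fst_swap, Prod.snd_swap] at h4
      refine ⟨?_, ?_⟩
      · change reducedCost N pot e ≤ 0
        rw [hred e he]; omega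
      · change rc e.swap = 0
        rw [hrcv, if_neg (fun h => hN.swap_notMem e he h.1), h3]
    · intro e he h1 h2 h3
      change reducedCost N pot e = 0
      rw [hred e he, h.inner e he h1 h2 h3]
      -- The last edge of a shortest path to `e.1` must be the reversal of `e`. It is tight with
      -- weight `0`, so both ends of `e` have the same distance and the reduced cost stays zero.
      obtain ⟨p, h4, -, -, h5⟩ := hpath e.1 (hN.wellFormed.2 e he).1
      obtain ⟨x, h6, h7⟩ := exists_rel_getLast h5 h4.1 h4.2.1 h2.symm
      obtain rfl := hinner e he h1 h2 h3 x h6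
      have h8 : G.weight (e.2, e.1) = 0 := (h.backward e he h1).2
      omega
  obtain ⟨p, h1, h2, h3, h4⟩ := hpath t hN.sink_mem
  have htight : p.IsChain (fun x y => r.pred y = some x ∧ IsTight N ⟨pot, rc, st.flow⟩ x y) := by
    rw [List.isChain_iff_getElem] at h3 h4 ⊢
    intro i hi
    refine ⟨h3 i hi, ?_⟩
    obtain ⟨h5, h6⟩ := h4 i hi
    rcases mem_arcs_residual.1 h5 with ⟨h7, h8⟩ | ⟨h7, h8⟩
    · refine ⟨?_, Or.inl ⟨h7, h8⟩⟩
      change rc _ = 0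
      rw [hrcv, if_pos ⟨h7, h8⟩, hred _ h7, ← (h.forward _ h7 h8).2, ← hGweight]
      simp only
      omega
    · have h9 := (h.zero_or_one _ h7).resolve_left h8
      -- On a simple path from `s` to `t` no edge enters `s` and none leaves `t`. So a reversal on
      -- the path belongs to an inner edge, whose true reduced cost is zero.
      have h10 : p[i + 1] ≠ s := by
        intro h10
        have h11 := h1.1
        rw [List.head?_eq_getElem?, List.getElem?_eq_getElem (by omega)] at h11
        rw [← Option.some.inj h11, h2.getElem_inj_iff] at h10
        omega
      have h12 : p[i] ≠ t := by
        intro h12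
        have h11 := h1.2.1
        rw [List.getLast?_eq_getElem?, List.getElem?_eq_getElem (by omega)] at h11
        rw [← Option.some.inj h11, h2.getElem_inj_iff] at h12
        omega
      refine ⟨?_, Or.inr ⟨h7, h9, hopt.inner _ h7 h9 h10 h12⟩⟩
      exact (hopt.backward _ h7 h9).2
  obtain ⟨q, hq⟩ : ∃ q, p.reverse = t :: q := by
    have h5 := h1.2.1
    rw [← List.head?_reverse] at h5
    cases h6 : p.reverse with
    | nil => rw [h6] at h5; simp at h5
    | cons a q => rw [h6] at h5; exact ⟨q, by simpa using h5⟩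
  -- A simple path has at most `n` vertices, so the counter `n` of `augment` lets it reach the
  -- source.
  have hlen : q.length < N.verts.length := by
    have h5 : p.length ≤ N.verts.length := by
      refine (h2.subperm ?_).length_le
      intro x hx
      obtain ⟨i, hi, rfl⟩ := List.getElem_of_mem hx
      cases i with
      | zero =>
        have h11 := h1.1
        rw [List.head?_eq_getElem?, List.getElem?_eq_getElem hi] at h11
        rw [Option.some.inj h11]
        exact hN.source_mem
      | succ i =>
        exact (hG.2 _ (List.isChain_iff_getElem.1 h1.2.2 i hi)).2
    have h6 : p.length = q.length + 1 := by
      rw [← List.length_reverse, hq, List.length_cons]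
    omega
  obtain ⟨h5, h6, -⟩ := hopt.augment hN (pred := r.pred) (k := N.verts.length) (q := q) (v := t)
    (b := fun p => (y + 1) * (p s - p t)) (fun p => by rw [hy p]; ring)
    (by rw [← hq, List.isChain_reverse]; exact htight)
    (by rw [← hq]; exact List.nodup_reverse.2 h2)
    (by rw [← hq, List.getLast?_reverse]; exact h1.1) hlen
  exact ⟨h5, h6⟩

end Residual

/-! ### Weak duality for costs and for values -/

section Duality

variable {V : Type}

theorem sum_map_sub_int {ι : Type} (l : List ι) (f g : ι → ℤ) :
    (l.map (fun e => f e - g e)).sum = (l.map f).sum - (l.map g).sum := by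
  induction l with
  | nil => simp
  | cons a l ih => simp only [List.map_cons, List.sum_cons, ih]; ring

theorem sum_map_nonneg_int {ι : Type} {l : List ι} {f : ι → ℤ} (h : ∀ e ∈ l, 0 ≤ f e) :
    0 ≤ (l.map f).sum := by
  refine List.sum_nonneg ?_
  simpa using h

/-- Node potentials as in an optimal state bound the costs of all other unit-capacity flows from
below. -/
theorem IsOptimalState.sum_le {N : Network V} {s t : V} {st : SSPState V}
    (h : IsOptimalState N s t st) {y k : ℤ} (hy : IsFlow N s t st.flow y) {f : V × V → ℤ}
    (hf : ∀ e ∈ N.arcs, 0 ≤ f e ∧ f e ≤ 1) (hk : IsFlow N s t f k) :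
    (N.arcs.map (fun e => st.flow e * N.weight e)).sum + (k - y) * (st.pot s - st.pot t) ≤
      (N.arcs.map (fun e => f e * N.weight e)).sum := by
  -- Each summand is `(f e - st.flow e)` times the reduced cost. Both factors are non-negative on
  -- empty edges and both are non-positive on edges with flow.
  have h1 : 0 ≤ (N.arcs.map (fun e => (f e * N.weight e - st.flow e * N.weight e) -
      (f e * (st.pot e.1 - st.pot e.2) - st.flow e * (st.pot e.1 - st.pot e.2)))).sum := by
    refine sum_map_nonneg_int fun e he => ?_
    have h2 : (f e * N.weight e - st.flow e * N.weight e) -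
      (f e * (st.pot e.1 - st.pot e.2) - st.flow e * (st.pot e.1 - st.pot e.2)) =
        (f e - st.flow e) * reducedCost N st.pot e := by rw [reducedCost]; ring
    rw [h2]
    obtain ⟨h3, h4⟩ := hf e he
    rcases h.zero_or_one e he with h0 | h0
    · have := (h.forward e he h0).1
      rw [h0]; exact mul_nonneg (by omega) this
    · have := (h.backward e he h0).1
      rw [h0]; exact mul_nonneg_of_nonpos_of_nonpos (by omega) this
  rw [sum_map_sub_int, sum_map_sub_int, sum_map_sub_int, hy, hk] at h1
  linarith

/-- A vertex set that contains the source but not the sink and is not left by residual edges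
bounds the flow value. -/
theorem IsOptimalState.value_le {N : Network V} {s t : V} {st : SSPState V}
    (h : IsOptimalState N s t st) {y k : ℤ} (hy : IsFlow N s t st.flow y) {f : V × V → ℤ}
    (hf : ∀ e ∈ N.arcs, 0 ≤ f e ∧ f e ≤ 1) (hk : IsFlow N s t f k) (S : V → Prop) (hs : S s)
    (ht : ¬ S t) (hS : ∀ e ∈ (residual N st).val.arcs, S e.1 → S e.2) : k ≤ y := by
  classical
  -- With this potential the flow identities measure the net flow out of `S`. Edges leaving `S` are
  -- saturated by the current flow and edges entering `S` are empty, so no flow sends more across.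
  let p : V → ℤ := fun v => if S v then 1 else 0
  have h1 : 0 ≤ (N.arcs.map (fun e => st.flow e * (p e.1 - p e.2) - f e * (p e.1 - p e.2))).sum := by
    refine sum_map_nonneg_int fun e he => ?_
    rw [← sub_mul]
    obtain ⟨h3, h4⟩ := hf e he
    rcases h.zero_or_one e he with h0 | h0
    · have h5 := hS _ (mem_arcs_residual.2 (Or.inl ⟨he, h0⟩))
      simp only at h5
      simp only [p]
      rw [h0]
      split_ifs <;> first | omega | tauto
    · have h5 := hS _ (mem_arcs_residual.2 (Or.inr ⟨he, by rw [h0]; decide⟩))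
      simp only at h5
      simp only [p]
      rw [h0]
      split_ifs <;> first | omega | tauto
  rw [sum_map_sub_int, hy, hk] at h1
  simp only [p, hs, ht, if_true, if_false] at h1
  linarith

end Duality

/-! ### The network of an instance and its unit flows -/

namespace RPC1Instance

open NVertex

variable {D R : Type} [DecidableEq D] [DecidableEq R] (I : RPC1Instance D R)

theorem mem_drivers {D R : Type} [DecidableEq D] (I : RPC1Instance D R) {d : D} :
    d ∈ I.drivers ↔ ∃ r, (d, r) ∈ I.feasible := by
  simp [drivers]

theorem mem_passengers {D R : Type} [DecidableEq R] (I : RPC1Instance D R) {r : R} :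
    r ∈ I.passengers ↔ ∃ d, (d, r) ∈ I.feasible := by
  simp [passengers]

theorem nodup_drivers {D R : Type} [DecidableEq D] (I : RPC1Instance D R) :
    I.drivers.Nodup := List.nodup_dedup _

theorem nodup_passengers {D R : Type} [DecidableEq R] (I : RPC1Instance D R) :
    I.passengers.Nodup := List.nodup_dedup _

theorem mem_arcs {x y : NVertex D R} : (x, y) ∈ I.network.arcs ↔
    (∃ d ∈ I.drivers, x = source ∧ y = driver d) ∨
    (∃ d r, (d, r) ∈ I.feasible ∧ x = driver d ∧ y = passenger r) ∨
    (∃ r ∈ I.passengers, x = passenger r ∧ y = sink) := by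
  simp only [network, List.mem_append, List.mem_map, Prod.mk.injEq, Prod.exists, or_assoc,
    eq_comm]

theorem mem_verts {v : NVertex D R} : v ∈ I.network.verts ↔ v = source ∨ v = sink ∨
    (∃ d ∈ I.drivers, v = driver d) ∨ ∃ r ∈ I.passengers, v = passenger r := by
  simp only [network, List.mem_cons, List.mem_append, List.mem_map, eq_comm]

theorem driver_arc {d : D} (h : d ∈ I.drivers) :
    ((source, driver d) : NVertex D R × NVertex D R) ∈ I.network.arcs :=
  I.mem_arcs.2 (Or.inl ⟨d, h, rfl, rfl⟩)

theorem match_arc {d : D} {r : R} (h : (d, r) ∈ I.feasible) :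
    ((driver d, passenger r) : NVertex D R × NVertex D R) ∈ I.network.arcs :=
  I.mem_arcs.2 (Or.inr (Or.inl ⟨d, r, h, rfl, rfl⟩))

theorem passenger_arc {r : R} (h : r ∈ I.passengers) :
    ((passenger r, sink) : NVertex D R × NVertex D R) ∈ I.network.arcs :=
  I.mem_arcs.2 (Or.inr (Or.inr ⟨r, h, rfl, rfl⟩))

theorem mem_verts_of_mem_arcs {e : NVertex D R × NVertex D R} (he : e ∈ I.network.arcs) :
    e.1 ∈ I.network.verts ∧ e.2 ∈ I.network.verts := by
  obtain ⟨x, y⟩ := e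
  rw [mem_arcs] at he
  rw [mem_verts, mem_verts]
  rcases he with ⟨d, hd, rfl, rfl⟩ | ⟨d, r, h, rfl, rfl⟩ | ⟨r, hr, rfl, rfl⟩
  · exact ⟨Or.inl rfl, Or.inr (Or.inr (Or.inl ⟨d, hd, rfl⟩))⟩
  · exact ⟨Or.inr (Or.inr (Or.inl ⟨d, I.mem_drivers.2 ⟨r, h⟩, rfl⟩)),
      Or.inr (Or.inr (Or.inr ⟨r, I.mem_passengers.2 ⟨d, h⟩, rfl⟩))⟩
  · exact ⟨Or.inr (Or.inr (Or.inr ⟨r, hr, rfl⟩)), Or.inr (Or.inl rfl)⟩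

theorem nodup_verts : I.network.verts.Nodup := by
  simp only [network, List.nodup_cons, List.mem_cons, List.mem_append, List.mem_map,
    List.nodup_append]
  refine ⟨by simp, by simp, ?_, ?_, ?_⟩
  · exact I.nodup_drivers.map (fun a b h => by simpa using h)
  · exact I.nodup_passengers.map (fun a b h => by simpa using h)
  · rintro a ⟨d, -, rfl⟩ b ⟨r, -, rfl⟩
    simp

theorem nodup_arcs : I.network.arcs.Nodup := by
  simp only [network, List.nodup_append, List.mem_append, List.mem_map]
  refine ⟨⟨?_, ?_, ?_⟩, ?_, ?_⟩
  · exact I.nodup_drivers.map (fun a b h => by simpa using h)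
  · exact I.nodup.map (fun a b h => by simpa [Prod.ext_iff] using h)
  · rintro a ⟨d, -, rfl⟩ b ⟨e, -, rfl⟩
    simp
  · exact I.nodup_passengers.map (fun a b h => by simpa using h)
  · rintro a (⟨d, -, rfl⟩ | ⟨e, -, rfl⟩) b ⟨r, -, rfl⟩ <;> simp

/-- The list runs from the source edges through the matches to the sink edges, layer by layer. This
is the topological order used by `bellmanFord_relaxed`. -/
theorem pairwise_arcs : I.network.arcs.Pairwise (fun e e' => e'.2 ≠ e.1) := by
  simp only [network, List.pairwise_append, List.pairwise_map, List.mem_append, List.mem_map]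
  refine ⟨⟨?_, ?_, ?_⟩, ?_, ?_⟩
  · exact List.pairwise_of_forall (by simp)
  · exact List.pairwise_of_forall (by simp)
  · rintro a ⟨d, -, rfl⟩ b ⟨e, -, rfl⟩
    simp
  · exact List.pairwise_of_forall (by simp)
  · rintro a (⟨d, -, rfl⟩ | ⟨e, -, rfl⟩) b ⟨r, -, rfl⟩ <;> simp

theorem verts_reweighted : I.reweighted.verts = I.network.verts := by
  rw [reweighted, val_johnson]

theorem arcs_reweighted : I.reweighted.arcs = I.network.arcs := by
  rw [reweighted, val_johnson]

theorem weight_reweighted {e : NVertex D R × NVertex D R} (he : e ∈ I.network.arcs) :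
    I.reweighted.weight e = I.network.weight e + johnsonPotential I.network source e.1 -
      johnsonPotential I.network source e.2 := by
  rw [reweighted, val_johnson]
  simp [he]

theorem isSimpleNetwork_reweighted : IsSimpleNetwork I.reweighted source sink := by
  constructor
  · rw [Network.WellFormed, verts_reweighted, arcs_reweighted]
    exact ⟨I.nodup_verts, fun e he => I.mem_verts_of_mem_arcs he⟩
  · rw [arcs_reweighted]; exact I.nodup_arcs
  · rw [arcs_reweighted]
    rintro ⟨x, y⟩ he he'
    rw [Prod.swap_prod_mk] at he'
    rw [mem_arcs] at he he'
    rcases he with ⟨d, hd, rfl, rfl⟩ | ⟨d, r, h, rfl, rfl⟩ | ⟨r, hr, rfl, rfl⟩ <;> simp at he'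
  · rw [verts_reweighted]; simp [network]
  · rw [verts_reweighted]; simp [network]
  · simp

/-- Any edge of `N` witnesses a feasible match, and then every vertex, including the sink, is
reachable from the source. Without a feasible match the sink would be unreachable. -/
theorem weight_reweighted_nonneg {e : NVertex D R × NVertex D R} (he : e ∈ I.network.arcs) :
    0 ≤ I.reweighted.weight e := by
  obtain ⟨d₀, r₀, h₀⟩ : ∃ d r, (d, r) ∈ I.feasible := by
    obtain ⟨x, y⟩ := e
    rcases I.mem_arcs.1 he with ⟨d, hd, -, -⟩ | ⟨d, r, h, -, -⟩ | ⟨r, hr, -, -⟩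
    · exact ⟨d, I.mem_drivers.1 hd⟩
    · exact ⟨d, r, h⟩
    · obtain ⟨d, h⟩ := I.mem_passengers.1 hr
      exact ⟨d, r, h⟩
  refine johnson_weight_nonneg (by simp [network]) (fun e he => I.mem_verts_of_mem_arcs he)
    I.pairwise_arcs ?_ ?_ e he
  · rintro ⟨x, y⟩ he
    rw [mem_arcs] at he
    rcases he with ⟨d, hd, rfl, rfl⟩ | ⟨d, r, h, rfl, rfl⟩ | ⟨r, hr, rfl, rfl⟩ <;> simp
  · intro S hs hS v hv
    have hd : ∀ d ∈ I.drivers, S (driver d) := fun d hd => hS _ (I.driver_arc hd) hs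
    have hr : ∀ r ∈ I.passengers, S (passenger r) := by
      intro r hr
      obtain ⟨d, h⟩ := I.mem_passengers.1 hr
      exact hS _ (I.match_arc h) (hd d (I.mem_drivers.2 ⟨r, h⟩))
    have hr₀ := I.mem_passengers.2 ⟨d₀, h₀⟩
    rcases I.mem_verts.1 hv with rfl | rfl | ⟨d, h1, rfl⟩ | ⟨r, h1, rfl⟩
    · exact hs
    · exact hS _ (I.passenger_arc hr₀) (hr r₀ hr₀)
    · exact hd d h1
    · exact hr r h1

/-- The sum over the edges of the flow network, split by the kind of the edge. -/
theorem sum_arcs (F : NVertex D R × NVertex D R → ℤ) : (I.network.arcs.map F).sum =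
    ∑ d ∈ I.drivers.toFinset, F (source, driver d) +
    ∑ e ∈ I.feasible.toFinset, F (driver e.1, passenger e.2) +
    ∑ r ∈ I.passengers.toFinset, F (passenger r, sink) := by
  rw [List.sum_toFinset _ I.nodup_drivers, List.sum_toFinset _ I.nodup,
    List.sum_toFinset _ I.nodup_passengers]
  simp [network, Function.comp_def, add_assoc]

/-- `f` is a flow of value `y` in the network with capacities one. -/
structure IsUnitFlow (f : NVertex D R × NVertex D R → ℤ) (y : ℤ) : Prop where
  zero_or_one : ∀ e ∈ I.network.arcs, f e = 0 ∨ f e = 1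
  isFlow : IsFlow I.network source sink f y

variable {I} {f : NVertex D R × NVertex D R → ℤ} {y : ℤ}

namespace IsUnitFlow

theorem nonneg (h : I.IsUnitFlow f y) {e : NVertex D R × NVertex D R} (he : e ∈ I.network.arcs) :
    0 ≤ f e := by
  rcases h.zero_or_one e he with h | h <;> omega

theorem le_one (h : I.IsUnitFlow f y) {e : NVertex D R × NVertex D R} (he : e ∈ I.network.arcs) :
    f e ≤ 1 := by
  rcases h.zero_or_one e he with h | h <;> omega

/-- Conservation at a vertex is the flow identity tested against the indicator function of that
vertex. -/
theorem driver_balance (h : I.IsUnitFlow f y) {d : D} (hd : d ∈ I.drivers) :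
    f (source, driver d) =
      ∑ e ∈ I.feasible.toFinset with e.1 = d, f (driver e.1, passenger e.2) := by
  have h1 := h.isFlow (fun v => if v = driver d then 1 else 0)
  rw [sum_arcs] at h1
  simp [hd, Finset.sum_ite_eq', Finset.sum_ite] at h1
  linarith

theorem passenger_balance (h : I.IsUnitFlow f y) {r : R} (hr : r ∈ I.passengers) :
    f (passenger r, sink) =
      ∑ e ∈ I.feasible.toFinset with e.2 = r, f (driver e.1, passenger e.2) := by
  have h1 := h.isFlow (fun v => if v = passenger r then 1 else 0)
  rw [sum_arcs] at h1
  simp [hr, Finset.sum_ite_eq', Finset.sum_ite] at h1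
  linarith

/-- The test potential is the indicator of the cut formed by the source and the drivers, which only
the matches cross. -/
theorem sum_feasible (h : I.IsUnitFlow f y) :
    ∑ e ∈ I.feasible.toFinset, f (driver e.1, passenger e.2) = y := by
  have h1 := h.isFlow (fun v => match v with
    | source => 1
    | driver _ => 1
    | _ => 0)
  rw [sum_arcs] at h1
  simpa using h1

theorem match_le_driver (h : I.IsUnitFlow f y) {d : D} {r : R} (he : (d, r) ∈ I.feasible) :
    f (driver d, passenger r) ≤ f (source, driver d) := by
  rw [h.driver_balance (I.mem_drivers.2 ⟨r, he⟩)]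
  refine Finset.single_le_sum (f := fun e : D × R => f (driver e.1, passenger e.2)) (a := (d, r))
    ?_ (by simpa using he)
  intro e he
  simp at he
  exact h.nonneg (I.match_arc he.1)

theorem match_le_passenger (h : I.IsUnitFlow f y) {d : D} {r : R} (he : (d, r) ∈ I.feasible) :
    f (driver d, passenger r) ≤ f (passenger r, sink) := by
  rw [h.passenger_balance (I.mem_passengers.2 ⟨d, he⟩)]
  refine Finset.single_le_sum (f := fun e : D × R => f (driver e.1, passenger e.2)) (a := (d, r))
    ?_ (by simpa using he)
  intro e he
  simp at he
  exact h.nonneg (I.match_arc he.1)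

/-- Two different passengers would require two units through a source edge of capacity one. -/
theorem driver_unique (h : I.IsUnitFlow f y) {d : D} {r r' : R} (he : (d, r) ∈ I.feasible)
    (he' : (d, r') ∈ I.feasible) (h1 : f (driver d, passenger r) = 1)
    (h2 : f (driver d, passenger r') = 1) : r = r' := by
  by_contra hne
  have hd := I.mem_drivers.2 ⟨r, he⟩
  have h3 := h.le_one (I.driver_arc hd)
  rw [h.driver_balance hd] at h3
  have h4 := Finset.sum_le_sum_of_subset_of_nonneg (s := {(d, r), (d, r')})
    (t := I.feasible.toFinset.filter (fun e => e.1 = d))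
    (f := fun e : D × R => f (driver e.1, passenger e.2))
    (by intro e; simp; rintro (rfl | rfl) <;> simp [he, he'])
    (by intro e he _; simp at he; exact h.nonneg (I.match_arc he.1))
  rw [Finset.sum_pair (by simp [hne])] at h4
  simp only [h1, h2] at h4
  linarith

theorem passenger_unique (h : I.IsUnitFlow f y) {d d' : D} {r : R} (he : (d, r) ∈ I.feasible)
    (he' : (d', r) ∈ I.feasible) (h1 : f (driver d, passenger r) = 1)
    (h2 : f (driver d', passenger r) = 1) : d = d' := by
  by_contra hne
  have hr := I.mem_passengers.2 ⟨d, he⟩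
  have h3 := h.le_one (I.passenger_arc hr)
  rw [h.passenger_balance hr] at h3
  have h4 := Finset.sum_le_sum_of_subset_of_nonneg (s := {(d, r), (d', r)})
    (t := I.feasible.toFinset.filter (fun e => e.2 = r))
    (f := fun e : D × R => f (driver e.1, passenger e.2))
    (by intro e; simp; rintro (rfl | rfl) <;> simp [he, he'])
    (by intro e he _; simp at he; exact h.nonneg (I.match_arc he.1))
  rw [Finset.sum_pair (by simp [hne])] at h4
  simp only [h1, h2] at h4
  linarith

end IsUnitFlow

/-- The matches with positive flow. -/
def flowMatching (I : RPC1Instance D R) (f : NVertex D R × NVertex D R → ℤ) : Finset (D × R) :=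
  I.feasible.toFinset.filter (fun e => 0 < f (driver e.1, passenger e.2))

namespace IsUnitFlow

theorem isMatching (h : I.IsUnitFlow f y) : I.IsMatching (I.flowMatching f) := by
  have key : ∀ e ∈ I.flowMatching f, e ∈ I.feasible ∧ f (driver e.1, passenger e.2) = 1 := by
    intro e he
    simp [flowMatching] at he
    refine ⟨he.1, ?_⟩
    rcases h.zero_or_one _ (I.match_arc he.1) with h0 | h0
    · omega
    · exact h0
  refine ⟨fun e he => (key e he).1, ?_⟩
  rintro ⟨d, r⟩ he ⟨d', r'⟩ he' hne
  obtain ⟨h1, h2⟩ := key _ he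
  obtain ⟨h3, h4⟩ := key _ he'
  constructor
  · rintro rfl
    exact hne (by rw [h.driver_unique h1 h3 h2 h4])
  · rintro rfl
    exact hne (by rw [h.passenger_unique h1 h3 h2 h4])

theorem sum_mul_eq (h : I.IsUnitFlow f y) (g : D × R → ℤ) :
    ∑ e ∈ I.feasible.toFinset, f (driver e.1, passenger e.2) * g e =
      ∑ e ∈ I.flowMatching f, g e := by
  rw [flowMatching, Finset.sum_filter]
  refine Finset.sum_congr rfl fun e he => ?_
  rcases h.zero_or_one _ (I.match_arc (by simpa using he)) with h0 | h0 <;> simp [h0]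

theorem card_flowMatching (h : I.IsUnitFlow f y) : ((I.flowMatching f).card : ℤ) = y := by
  have := h.sum_mul_eq (fun _ => 1)
  simp only [mul_one, h.sum_feasible] at this
  simp [this]

theorem sum_weight (h : I.IsUnitFlow f y) :
    (I.network.arcs.map (fun e => f e * I.network.weight e)).sum =
      -I.totalProfit (I.flowMatching f) := by
  rw [sum_arcs]
  have := h.sum_mul_eq (fun e => -I.profit e)
  simp only [network, mul_zero, Finset.sum_const_zero, zero_add, add_zero, totalProfit, this,
    Finset.sum_neg_distrib]

theorem flowCost_eq (h : I.IsUnitFlow f y) :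
    I.network.flowCost f = -I.totalProfit (I.flowMatching f) := by
  rw [← h.sum_weight, Network.flowCost]
  have key : ∀ l : List (NVertex D R × NVertex D R), (∀ e ∈ l, f e = 0 ∨ f e = 1) →
      ((l.filter (fun e => 0 < f e)).map I.network.weight).sum =
        (l.map (fun e => f e * I.network.weight e)).sum := by
    intro l hl
    induction l with
    | nil => rfl
    | cons e l ih =>
      have ih := ih (fun e he => hl e (by simp [he]))
      rcases hl e (by simp) with h0 | h0 <;> simp [h0, ih]
  exact key _ h.zero_or_one

/-- Unmatched drivers are reached directly from the source. A matched driver is reached from the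
sink, back through its passenger, whose sink edge carries flow. A passenger is reached from the sink
if its sink edge carries flow, and otherwise from any adjacent driver. -/
theorem reachable {st : SSPState (NVertex D R)} (h : I.IsUnitFlow st.flow y)
    (S : NVertex D R → Prop) (hs : S source) (ht : S sink)
    (hS : ∀ e ∈ (residual I.reweighted st).val.arcs, S e.1 → S e.2) :
    ∀ v ∈ I.network.verts, S v := by
  have hf : ∀ x y, (x, y) ∈ I.network.arcs → st.flow (x, y) = 0 → S x → S y := by
    intro x y h1 h2 h3
    exact hS (x, y) (mem_arcs_residual.2 (Or.inl ⟨by rwa [arcs_reweighted], h2⟩)) h3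
  have hb : ∀ x y, (x, y) ∈ I.network.arcs → st.flow (x, y) ≠ 0 → S y → S x := by
    intro x y h1 h2 h3
    exact hS (y, x) (mem_arcs_residual.2 (Or.inr ⟨by rwa [arcs_reweighted], h2⟩)) h3
  have hd : ∀ d ∈ I.drivers, S (driver d) := by
    intro d hd
    by_cases h0 : st.flow (source, driver d) = 0
    · exact hf _ _ (I.driver_arc hd) h0 hs
    · rw [h.driver_balance hd] at h0
      obtain ⟨⟨d', r⟩, he, h1⟩ := Finset.exists_ne_zero_of_sum_ne_zero h0
      simp at he h1
      obtain ⟨he, rfl⟩ := he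
      refine hb _ _ (I.match_arc he) h1 (hb _ _ (I.passenger_arc (I.mem_passengers.2 ⟨_, he⟩)) ?_ ht)
      have h2 := h.match_le_passenger he
      have h3 := h.nonneg (I.match_arc he)
      omega
  intro v hv
  rcases I.mem_verts.1 hv with rfl | rfl | ⟨d, h1, rfl⟩ | ⟨r, h1, rfl⟩
  · exact hs
  · exact ht
  · exact hd d h1
  · by_cases h0 : st.flow (passenger r, sink) = 0
    · obtain ⟨d, he⟩ := I.mem_passengers.1 h1
      refine hf _ _ (I.match_arc he) ?_ (hd d (I.mem_drivers.2 ⟨r, he⟩))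
      have h2 := h.match_le_passenger he
      have h3 := h.nonneg (I.match_arc he)
      omega
    · exact hb _ _ (I.passenger_arc h1) h0 ht

/-- The only residual edge that enters a matched driver comes from its passenger. -/
theorem residual_inner {st : SSPState (NVertex D R)} (h : I.IsUnitFlow st.flow y)
    {e : NVertex D R × NVertex D R} (he : e ∈ I.network.arcs) (h1 : st.flow e = 1)
    (hs : e.1 ≠ source) (ht : e.2 ≠ sink) {x : NVertex D R}
    (hx : (x, e.1) ∈ (residual I.reweighted st).val.arcs) : x = e.2 := by
  obtain ⟨a, b⟩ := e
  simp only at hs ht hx ⊢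
  rcases I.mem_arcs.1 he with ⟨d, hd, rfl, rfl⟩ | ⟨d, r, hf, rfl, rfl⟩ | ⟨r, hr, rfl, rfl⟩
  · exact absurd rfl hs
  · rw [mem_arcs_residual, arcs_reweighted] at hx
    rcases hx with ⟨h2, h3⟩ | ⟨h2, h3⟩
    · obtain ⟨-, rfl⟩ : d ∈ I.drivers ∧ x = source := by
        simpa [mem_arcs] using h2
      -- A matched driver has a saturated source edge, so the source cannot be the tail of a
      -- residual edge into it.
      have := h.match_le_driver hf
      omega
    · have h4 := (h.zero_or_one _ h2).resolve_left h3
      obtain ⟨r', h5, rfl⟩ : ∃ r', (d, r') ∈ I.feasible ∧ x = passenger r' := by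
        simpa [mem_arcs] using h2
      rw [h.driver_unique hf h5 h1 h4]
  · exact absurd rfl ht

end IsUnitFlow

theorem isFlow_reweighted : IsFlow I.reweighted source sink f y ↔
    IsFlow I.network source sink f y := by
  rw [IsFlow, IsFlow, arcs_reweighted]

theorem isUnitFlow_of_isOptimalState {st : SSPState (NVertex D R)}
    (h : IsOptimalState I.reweighted source sink st)
    (hy : IsFlow I.reweighted source sink st.flow y) : I.IsUnitFlow st.flow y where
  zero_or_one := by simpa only [arcs_reweighted] using h.zero_or_one
  isFlow := isFlow_reweighted.1 hy

variable (I) in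
-- This is the invariant of Step 2. The zero potentials certify the empty flow because the
-- reweighted costs are non-negative; `reachable` and `residual_inner` supply what the general
-- iteration needs from the bipartite network.
theorem stateAfter_spec {sssp : SSSPProcedure (NVertex D R)} (hsssp : SolvesSSSP sssp) (y : ℕ)
    {st : SSPState (NVertex D R)} (hst : I.stateAfter sssp y = some st) :
    IsOptimalState I.reweighted source sink st ∧
      IsFlow I.reweighted source sink st.flow y := by
  induction y generalizing st with
  | zero =>
    obtain rfl := Option.some.inj hst
    rw [val_initialState]
    refine ⟨⟨fun _ _ => Or.inl rfl, fun _ _ => rfl, ?_, by simp, by simp⟩, by simp [IsFlow]⟩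
    intro e he _
    simp only [reducedCost, he, if_true, sub_zero, add_zero, and_true]
    exact I.weight_reweighted_nonneg (by rwa [arcs_reweighted] at he)
  | succ y ih =>
    rw [stateAfter, Option.bind_eq_some_iff] at hst
    obtain ⟨st', h1, h2⟩ := hst
    obtain ⟨h3, h4⟩ := ih h1
    have h5 := isUnitFlow_of_isOptimalState h3 h4
    rw [Nat.cast_succ]
    refine h3.nextFlow hsssp I.isSimpleNetwork_reweighted h4 ?_ ?_ h2
    · intro S hs ht hS v hv
      exact h5.reachable S hs ht hS v (by rwa [verts_reweighted] at hv)
    · intro e he h6 h7 h8 x hx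
      exact h5.residual_inner (by rwa [arcs_reweighted] at he) h6 h7 h8 hx

end RPC1Instance

/-! ### Matchings as flows, convexity of the costs and exactness -/

namespace RPC1Instance

open NVertex

variable {D R : Type} [DecidableEq D] [DecidableEq R] {I : RPC1Instance D R}

theorem exists_isUnitFlow {M : Finset (D × R)} (hM : I.IsMatching M) :
    ∃ f, I.IsUnitFlow f M.card ∧ I.flowMatching f = M := by
  -- Source and sink edges carry the degree of their driver or passenger in `M`, which is `0` or
  -- `1`.
  let f : NVertex D R × NVertex D R → ℤ := fun e => match e with
    | (source, driver d) => ((M.filter (fun e => e.1 = d)).card : ℤ)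
    | (driver d, passenger r) => if (d, r) ∈ M then 1 else 0
    | (passenger r, sink) => ((M.filter (fun e => e.2 = r)).card : ℤ)
    | _ => 0
  have hcard : ∀ s : Finset (D × R), s.card ≤ 1 → (s.card : ℤ) = 0 ∨ (s.card : ℤ) = 1 := by
    intro s hs; omega
  have hfm : I.flowMatching f = M := by
    ext ⟨d, r⟩
    simp only [flowMatching, Finset.mem_filter, List.mem_toFinset, f]
    constructor
    · rintro ⟨-, h⟩
      by_contra h'
      simp [h'] at h
    · intro h
      exact ⟨hM.1 _ h, by simp [h]⟩
  refine ⟨f, ⟨?_, ?_⟩, hfm⟩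
  · rintro ⟨x, y⟩ he
    rcases I.mem_arcs.1 he with ⟨d, hd, rfl, rfl⟩ | ⟨d, r, h, rfl, rfl⟩ | ⟨r, hr, rfl, rfl⟩
    · refine hcard _ (Finset.card_le_one.2 ?_)
      intro a ha b hb
      simp only [Finset.mem_filter] at ha hb
      by_contra hne
      exact (hM.2 a ha.1 b hb.1 hne).1 (ha.2.trans hb.2.symm)
    · simp only [f]
      split_ifs <;> simp
    · refine hcard _ (Finset.card_le_one.2 ?_)
      intro a ha b hb
      simp only [Finset.mem_filter] at ha hb
      by_contra hne
      exact (hM.2 a ha.1 b hb.1 hne).2 (ha.2.trans hb.2.symm)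
  · intro p
    rw [sum_arcs]
    have h1 : ∑ d ∈ I.drivers.toFinset, f (source, driver d) * (p source - p (driver d)) =
        ∑ e ∈ M, (p source - p (driver e.1)) := by
      rw [← Finset.sum_fiberwise_of_maps_to (g := Prod.fst) (t := I.drivers.toFinset)]
      · refine Finset.sum_congr rfl fun d _ => ?_
        rw [Finset.sum_congr rfl (g := fun _ => p source - p (driver d))
          (fun e he => by rw [(Finset.mem_filter.1 he).2]), Finset.sum_const, nsmul_eq_mul]
      · rintro ⟨d, r⟩ he
        simpa using I.mem_drivers.2 ⟨r, hM.1 _ he⟩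
    have h2 : ∑ r ∈ I.passengers.toFinset, f (passenger r, sink) * (p (passenger r) - p sink) =
        ∑ e ∈ M, (p (passenger e.2) - p sink) := by
      rw [← Finset.sum_fiberwise_of_maps_to (g := Prod.snd) (t := I.passengers.toFinset)]
      · refine Finset.sum_congr rfl fun r _ => ?_
        rw [Finset.sum_congr rfl (g := fun _ => p (passenger r) - p sink)
          (fun e he => by rw [(Finset.mem_filter.1 he).2]), Finset.sum_const, nsmul_eq_mul]
      · rintro ⟨d, r⟩ he
        simpa using I.mem_passengers.2 ⟨d, hM.1 _ he⟩
    have h3 : ∑ e ∈ I.feasible.toFinset,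
        f (driver e.1, passenger e.2) * (p (driver e.1) - p (passenger e.2)) =
        ∑ e ∈ M, (p (driver e.1) - p (passenger e.2)) := by
      rw [← Finset.sum_subset (s₁ := M) (fun e he => by simpa using hM.1 e he)]
      · refine Finset.sum_congr rfl fun e he => ?_
        simp [f, he]
      · intro e _ he
        simp [f, he]
    simp only [h1, h2, h3]
    -- For each edge of `M`, the three potential differences along its source-sink path telescope.
    rw [← Finset.sum_add_distrib, ← Finset.sum_add_distrib, Finset.sum_congr rfl
      (g := fun _ => p source - p sink) (fun e _ => by ring), Finset.sum_const, nsmul_eq_mul]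

theorem IsMatching.card_le_nMin {M : Finset (D × R)} (hM : I.IsMatching M) :
    M.card ≤ I.nMin := by
  refine le_min ?_ ?_
  · rw [← Finset.card_image_of_injOn (s := M) (f := Prod.fst),
      ← List.toFinset_card_of_nodup I.nodup_drivers]
    · refine Finset.card_le_card ?_
      intro d hd
      obtain ⟨e, he, rfl⟩ := Finset.mem_image.1 hd
      simpa using I.mem_drivers.2 ⟨e.2, hM.1 e he⟩
    · intro a ha b hb hab
      by_contra hne
      exact (hM.2 a ha b hb hne).1 hab
  · rw [← Finset.card_image_of_injOn (s := M) (f := Prod.snd),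
      ← List.toFinset_card_of_nodup I.nodup_passengers]
    · refine Finset.card_le_card ?_
      intro d hd
      obtain ⟨e, he, rfl⟩ := Finset.mem_image.1 hd
      simpa using I.mem_passengers.2 ⟨e.1, hM.1 e he⟩
    · intro a ha b hb hab
      by_contra hne
      exact (hM.2 a ha b hb hne).2 hab

/-- The flow identity for the potential `h` shows that reweighting shifts all flows of one value by
the same amount, so comparisons of their costs are unaffected. -/
theorem IsUnitFlow.sum_reweighted {f : NVertex D R × NVertex D R → ℤ} {y : ℤ}
    (h : I.IsUnitFlow f y) : (I.network.arcs.map (fun e => f e * I.reweighted.weight e)).sum =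
      I.network.flowCost f + y * (johnsonPotential I.network source source -
        johnsonPotential I.network source sink) := by
  rw [← h.isFlow, h.flowCost_eq, ← h.sum_weight, ← List.sum_map_add]
  congr 1
  refine List.map_congr_left fun e he => ?_
  rw [I.weight_reweighted he]
  ring

section

variable {sssp : SSSPProcedure (NVertex D R)} (hsssp : SolvesSSSP sssp) {y : ℕ}
  {st : SSPState (NVertex D R)}

include hsssp

theorem isUnitFlow_stateAfter (hst : I.stateAfter sssp y = some st) : I.IsUnitFlow st.flow y :=
  have h := I.stateAfter_spec hsssp y hst
  isUnitFlow_of_isOptimalState h.1 h.2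

/-- The flow `f_y` has least cost, and the slope of the piecewise linear least cost function at `y`
bounds the costs of the other matchings. -/
theorem exists_slope (hst : I.stateAfter sssp y = some st) :
    ∃ c : ℤ, ∀ M, I.IsMatching M →
      I.network.flowCost st.flow + ((M.card : ℤ) - y) * c ≤ -I.totalProfit M := by
  obtain ⟨h1, h2⟩ := I.stateAfter_spec hsssp y hst
  have h3 := isUnitFlow_of_isOptimalState h1 h2
  -- The slope in the reweighted network is the potential drop; the second difference undoes the
  -- shift per unit of flow caused by the reweighting.
  refine ⟨(st.pot source - st.pot sink) - (johnsonPotential I.network source source -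
        johnsonPotential I.network source sink), fun M hM => ?_⟩
  obtain ⟨f, hf, rfl⟩ := exists_isUnitFlow hM
  have h4 := h1.sum_le h2 (f := f) (by
    rw [arcs_reweighted]; exact fun e he => ⟨hf.nonneg he, hf.le_one he⟩)
    (isFlow_reweighted.2 hf.isFlow)
  rw [arcs_reweighted, h3.sum_reweighted, hf.sum_reweighted] at h4
  rw [← hf.flowCost_eq]
  linarith

theorem flowCost_le_of_card_eq (hst : I.stateAfter sssp y = some st) {M : Finset (D × R)}
    (hM : I.IsMatching M) (hy : M.card = y) :
    I.network.flowCost st.flow ≤ -I.totalProfit M := by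
  obtain ⟨c, hc⟩ := exists_slope hsssp hst
  simpa [hy] using hc M hM

/-- After the first increase the costs do not decrease any more. -/
theorem flowCost_le_of_increase (hst : I.stateAfter sssp y = some st)
    {st' : SSPState (NVertex D R)} (hst' : I.stateAfter sssp (y + 1) = some st')
    (hlt : I.network.flowCost st.flow < I.network.flowCost st'.flow) {M : Finset (D × R)}
    (hM : I.IsMatching M) (hy : y + 1 ≤ M.card) :
    I.network.flowCost st'.flow ≤ -I.totalProfit M := by
  obtain ⟨c, hc⟩ := exists_slope hsssp hst'
  have h1 := isUnitFlow_stateAfter hsssp hst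
  -- The bound at `y + 1`, applied to the matching of `f_y`, reads `c(f_{y+1}) - c ≤ c(f_y)`. The
  -- strict increase thus makes the slope positive.
  have h2 := hc _ h1.isMatching
  rw [h1.card_flowMatching, ← h1.flowCost_eq] at h2
  push_cast at h2
  have h3 := hc M hM
  have h4 : 0 < c := by linarith
  have h5 : (0 : ℤ) ≤ (M.card : ℤ) - ((y + 1 : ℕ) : ℤ) := by omega
  have := mul_nonneg h5 h4.le
  linarith

/-- The vertices at finite distance form a set that no residual edge leaves and that omits the sink,
so `value_le` applies. -/
theorem card_le_of_nextFlow_eq_none (hst : I.stateAfter sssp y = some st)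
    (hnext : (nextFlow sssp I.reweighted source sink st).val = none) {M : Finset (D × R)}
    (hM : I.IsMatching M) : M.card ≤ y := by
  obtain ⟨h1, h2⟩ := I.stateAfter_spec hsssp y hst
  obtain ⟨f, hf, rfl⟩ := exists_isUnitFlow hM
  have htop := nextFlow_eq_none hnext
  have hN := I.isSimpleNetwork_reweighted
  obtain ⟨hG, hGw⟩ := h1.residual_wellFormed hN
  have hr := hsssp (residual I.reweighted st).val source hG hN.source_mem hGw
  have hs0 := hr.le_pathWeight source hN.source_mem [source] (Network.IsPath.singleton _ source)
  have := h1.value_le h2 (f := f) (by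
    rw [arcs_reweighted]; exact fun e he => ⟨hf.nonneg he, hf.le_one he⟩)
    (isFlow_reweighted.2 hf.isFlow)
    (fun v => (sssp (residual I.reweighted st).val source).val.dist v ≠ ⊤)
    (ne_top_of_le_ne_top (WithTop.coe_ne_top) hs0) (by simpa using htop) (by
      intro e he h5
      refine ne_top_of_le_ne_top ?_ (hr.dist_le hG he)
      simp [h5])
  exact_mod_cast this

end

theorem val_computeCost {V : Type} (N : Network V) (h : V → ℤ) (flow : V × V → ℤ) :
    (computeCost N h flow).val =
      ((N.arcs.filter (fun e => 0 < flow e)).map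
        (fun e => N.weight e + h e.2 - h e.1)).sum := by
  have key : ∀ (l : List (V × V)) (a : ℤ),
      l.foldl (fun a e => if 0 < flow e then a + (N.weight e + h e.2 - h e.1) else a) a =
        a + ((l.filter (fun e => 0 < flow e)).map
          (fun e => N.weight e + h e.2 - h e.1)).sum := by
    intro l
    induction l with
    | nil => simp
    | cons e l ih =>
      intro a
      rw [List.foldl_cons, ih]
      by_cases h0 : 0 < flow e
      · simp [h0]; ring
      · simp [h0]
  simp only [computeCost, ↓val_bind, val_forEach, ↓val_ite, val_read, val_pure]
  exact (key N.arcs 0).trans (zero_add _)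

theorem val_computeCost_reweighted (flow : NVertex D R × NVertex D R → ℤ) :
    (computeCost I.reweighted (johnsonPotential I.network source) flow).val =
      I.network.flowCost flow := by
  rw [val_computeCost, arcs_reweighted, Network.flowCost]
  congr 1
  refine List.map_congr_left fun e he => ?_
  rw [I.weight_reweighted (List.mem_of_mem_filter he)]
  ring

theorem flowLoop_succ (sssp : SSSPProcedure (NVertex D R)) (N : Network (NVertex D R))
    (h : NVertex D R → ℤ) (s t : NVertex D R) (c : ℝ) (k : ℕ) (st : SSPState (NVertex D R))
    (cost : ℤ) : (flowLoop sssp N h s t c (k + 1) st cost).val =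
      match (nextFlow sssp N s t st).val with
      | none => st.flow
      | some st' =>
        if cost < (computeCost N h st'.flow).val ∧ -c < ((computeCost N h st'.flow).val : ℝ) then
          st.flow
        else (flowLoop sssp N h s t c k st' (computeCost N h st'.flow).val).val := by
  rw [flowLoop]
  simp only [↓val_bind]
  cases (nextFlow sssp N s t st).val with
  | none => rfl
  | some st' =>
    simp only [↓val_bind, ↓val_ite, val_pure]

/-- The flow that Step 2 ends with decides the problem. -/
theorem flowLoop_spec {sssp : SSSPProcedure (NVertex D R)} (hsssp : SolvesSSSP sssp) (c : ℝ)
    {k y : ℕ} (hk : y + k = I.nMin) {st : SSPState (NVertex D R)}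
    (hst : I.stateAfter sssp y = some st)
    (hprev : -c < (I.network.flowCost st.flow : ℝ) → ∀ M, I.IsMatching M →
      c ≤ (I.totalProfit M : ℝ) → y < M.card) :
    ∃ z st', I.stateAfter sssp z = some st' ∧
      (flowLoop sssp I.reweighted (johnsonPotential I.network source) source sink c k st
        (I.network.flowCost st.flow)).val = st'.flow ∧
      (-c < (I.network.flowCost st'.flow : ℝ) → ∀ M, I.IsMatching M →
        ¬ c ≤ (I.totalProfit M : ℝ)) ∧
      ∀ M, I.IsMatching M → c ≤ (I.totalProfit M : ℝ) → M.card ≤ z := by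
  -- The invariant `hprev` says that if `f_y` misses the target, then so does every matching with at
  -- most `y` edges. Together with an upper bound `y` on the sizes of acceptable matchings it
  -- settles each way of ending the loop.
  induction k generalizing y st with
  | zero =>
    have hle : ∀ M, I.IsMatching M → M.card ≤ y := fun M hM => by
      have := hM.card_le_nMin
      omega
    exact ⟨y, st, hst, rfl, fun h M hM hc => absurd (hprev h M hM hc) (not_lt.2 (hle M hM)),
      fun M hM _ => hle M hM⟩
  | succ k ih =>
    rw [flowLoop_succ]
    cases hnext : (nextFlow sssp I.reweighted source sink st).val with
    | none =>
      have hle : ∀ M, I.IsMatching M → M.card ≤ y := fun M hM =>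
        card_le_of_nextFlow_eq_none hsssp hst hnext hM
      exact ⟨y, st, hst, rfl, fun h M hM hc => absurd (hprev h M hM hc) (not_lt.2 (hle M hM)),
        fun M hM _ => hle M hM⟩
    | some st' =>
      have hst' : I.stateAfter sssp (y + 1) = some st' := by
        rw [stateAfter, hst, Option.bind_some, hnext]
      simp only [val_computeCost_reweighted]
      by_cases hincr : I.network.flowCost st.flow < I.network.flowCost st'.flow ∧
          -c < (I.network.flowCost st'.flow : ℝ)
      · rw [if_pos hincr]
        have hle : ∀ M, I.IsMatching M → c ≤ (I.totalProfit M : ℝ) → M.card ≤ y := by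
          intro M hM hc
          by_contra hlt
          have h1 := flowCost_le_of_increase hsssp hst hst' hincr.1 hM (by omega)
          have h2 : (I.network.flowCost st'.flow : ℝ) ≤ -(I.totalProfit M : ℝ) := by
            exact_mod_cast h1
          linarith [hincr.2]
        exact ⟨y, st, hst, rfl,
          fun h M hM hc => absurd (hprev h M hM hc) (not_lt.2 (hle M hM hc)), hle⟩
      · rw [if_neg hincr]
        refine ih (by omega) hst' ?_
        intro hlt M hM hc
        -- The loop goes on although `f_{y+1}` misses the target, so the cost did not rise and `f_y`
        -- missed it as well. It remains to exclude size `y + 1`, where `f_{y+1}` is cheapest.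
        have h1 : I.network.flowCost st'.flow ≤ I.network.flowCost st.flow := by
          by_contra h
          exact hincr ⟨not_le.1 h, hlt⟩
        have h2 : -c < (I.network.flowCost st.flow : ℝ) :=
          hlt.trans_le (by exact_mod_cast h1)
        have h3 := hprev h2 M hM hc
        refine lt_of_le_of_ne h3 fun h4 => ?_
        have h5 : (I.network.flowCost st'.flow : ℝ) ≤ -(I.totalProfit M : ℝ) := by
          exact_mod_cast flowCost_le_of_card_eq hsssp hst' hM h4.symm
        linarith

variable (I) in
theorem val_extractMatching (f : NVertex D R × NVertex D R → ℤ) :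
    (I.extractMatching f).val.Nodup ∧ (I.extractMatching f).val.toFinset = I.flowMatching f := by
  have key : ∀ (l M : List (D × R)),
      l.foldl (fun M e => if 0 < f (driver e.1, passenger e.2) then e :: M else M) M =
        (l.filter (fun e => 0 < f (driver e.1, passenger e.2))).reverse ++ M := by
    intro l
    induction l with
    | nil => simp
    | cons e l ih =>
      intro M
      rw [List.foldl_cons, ih]
      by_cases h0 : 0 < f (driver e.1, passenger e.2)
      · simp [h0]
      · simp [h0]
  have h : (I.extractMatching f).val =
      (I.feasible.filter (fun e => 0 < f (driver e.1, passenger e.2))).reverse := by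
    simp only [extractMatching, ↓val_bind, val_forEach, ↓val_ite, val_read, val_pure]
    exact (key _ _).trans (List.append_nil _)
  rw [h]
  refine ⟨List.nodup_reverse.2 (I.nodup.filter _), ?_⟩
  ext e
  simp [flowMatching]

variable (I) in
theorem val_exactNF2 (sssp : SSSPProcedure (NVertex D R)) (c : ℝ) :
    (I.exactNF2 sssp c).val =
      let st := (initialState I.reweighted).val
      let flow := (flowLoop sssp I.reweighted (johnsonPotential I.network source) source sink c
        I.nMin st (I.network.flowCost st.flow)).val
      if (I.network.flowCost flow : ℝ) ≤ -c then some (I.extractMatching flow).val else none := by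
  have h1 : (johnson I.network source).val = (I.reweighted, johnsonPotential I.network source) := by
    rw [reweighted, val_johnson]
  have h2 : I.constructNetwork.val = I.network := rfl
  simp only [exactNF2, ↓val_bind, h2, h1, ↓val_ite, val_pure, val_computeCost_reweighted]

/-- The output of ExactNF2 is right. -/
theorem exactNF2_correct {sssp : SSSPProcedure (NVertex D R)} (hsssp : SolvesSSSP sssp) (c : ℝ) :
    (∀ M, (I.exactNF2 sssp c).val = some M → M.Nodup ∧ I.IsSolution c M.toFinset) ∧
      ((I.exactNF2 sssp c).val = none →
        ¬ ∃ M : Finset (D × R), I.IsMatching M ∧ c ≤ (I.totalProfit M : ℝ)) := by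
  have h0 : I.stateAfter sssp 0 = some (initialState I.reweighted).val := rfl
  -- The invariant holds initially since `f₀` is cheapest among flows of value zero: if it misses
  -- the target, so does the empty matching.
  obtain ⟨z, st, hst, hflow, h1, h2⟩ := flowLoop_spec hsssp c (zero_add I.nMin) h0 (by
    intro hlt M hM hc
    rw [Nat.pos_iff_ne_zero]
    intro hcard
    have h5 : (I.network.flowCost (initialState I.reweighted).val.flow : ℝ) ≤
        -(I.totalProfit M : ℝ) := by
      exact_mod_cast flowCost_le_of_card_eq hsssp h0 hM hcard
    linarith)
  rw [val_exactNF2]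
  simp only [hflow]
  by_cases hle : (I.network.flowCost st.flow : ℝ) ≤ -c
  · simp only [if_pos hle, Option.some.injEq, reduceCtorEq, false_implies, and_true]
    rintro M rfl
    obtain ⟨h3, h4⟩ := I.val_extractMatching st.flow
    have h5 := isUnitFlow_stateAfter hsssp hst
    rw [h4]
    refine ⟨h3, h5.isMatching, ?_, ?_⟩
    · rw [h5.flowCost_eq] at hle
      push_cast at hle
      linarith
    · intro M' hM' hc
      have h6 := h2 M' hM' hc
      have h7 := h5.card_flowMatching
      omega
  · simp only [if_neg hle, reduceCtorEq, false_implies, implies_true, true_and, forall_const]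
    rintro ⟨M, hM, hc⟩
    exact h1 (not_le.1 hle) M hM hc

theorem flowCost_le_of_isFlowFound {sssp : SSSPProcedure (NVertex D R)} (hsssp : SolvesSSSP sssp)
    {y z : ℕ} {f f' g : NVertex D R × NVertex D R → ℤ} (hyz : y + 1 < z)
    (hf : I.IsFlowFound sssp y f) (hf' : I.IsFlowFound sssp (y + 1) f')
    (hg : I.IsFlowFound sssp z g) (hlt : I.network.flowCost f < I.network.flowCost f') :
    I.network.flowCost f' ≤ I.network.flowCost g := by
  obtain ⟨st, hst, rfl⟩ := hf
  obtain ⟨st', hst', rfl⟩ := hf'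
  obtain ⟨st'', hst'', rfl⟩ := hg
  have h := isUnitFlow_stateAfter hsssp hst''
  rw [h.flowCost_eq]
  refine flowCost_le_of_increase hsssp hst hst' hlt h.isMatching ?_
  have := h.card_flowMatching
  omega

end RPC1Instance

/-! ### Step bounds for the subroutines -/

namespace Timed

variable {α β : Type}

theorem steps_bind_le {x : Timed α} {f : α → Timed β} {a b : ℕ} (hx : x.steps ≤ a)
    (hf : ∀ v, (f v).steps ≤ b) : (x >>= f).steps ≤ a + b :=
  Nat.add_le_add hx (hf _)

theorem steps_ite_le {p : Prop} [Decidable p] {x y : Timed α} {b : ℕ} (hx : x.steps ≤ b)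
    (hy : y.steps ≤ b) : (if p then x else y).steps ≤ b := by
  split_ifs
  · exact hx
  · exact hy

end Timed

section Steps

variable {V : Type} [DecidableEq V]

theorem steps_bellmanFord_le (G : Network V) (s : V) : (bellmanFord G s).steps ≤
    G.verts.length + (1 + ((7 * G.arcs.length + 2) * (G.verts.length - 1) + 1)) := by
  refine steps_bind_le le_rfl fun d => steps_bind_le le_rfl fun d => ?_
  refine steps_repeatFor_le _ _ _ fun d => steps_forEach_le (B := 6) _ _ _ fun d e => ?_
  refine steps_bind_le (a := 1) (b := 5) le_rfl fun du =>
    steps_bind_le (a := 1) (b := 4) le_rfl fun dv => steps_bind_le (a := 1) (b := 3) le_rfl fun w =>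
    steps_bind_le (a := 2) (b := 1) le_rfl fun _ => steps_ite_le le_rfl (Nat.zero_le _)

theorem steps_johnson_le (N : Network V) (s : V) : (johnson N s).steps ≤
    (3 * N.arcs.length + 1) + (N.verts.length + ((N.verts.length +
      (1 + ((7 * N.arcs.length + 2) * (N.verts.length - 1) + 1)) + (3 * N.verts.length + 1)) +
      (N.verts.length * N.verts.length + ((7 * N.arcs.length + 1) + 0)))) := by
  have hrest : ∀ h : V → ℤ, (do
      let w' ← newArray (N.verts.length * N.verts.length) 0
      let w' ← forEach N.arcs w' (fun w' e => do
        let w ← Timed.read N.weight e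
        let hu ← Timed.read h e.1
        let hv ← Timed.read h e.2
        tick 2
        write w' e (w + hu - hv))
      pure ((⟨N.verts, N.arcs, w'⟩, h) : Network V × (V → ℤ))).steps ≤
        N.verts.length * N.verts.length + ((7 * N.arcs.length + 1) + 0) := by
    intro h
    refine steps_bind_le le_rfl fun w' => steps_bind_le ?_ fun _ => le_rfl
    exact steps_forEach_le (B := 6) _ _ _ fun _ _ => le_rfl
  refine steps_bind_le ?_ fun b => steps_bind_le le_rfl fun h => steps_ite_le ?_ ?_
  · exact steps_forEach_le (B := 2) _ _ _ fun _ _ => le_rfl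
  · rw [Nat.add_assoc]
    refine steps_bind_le (steps_bellmanFord_le N s) fun d => steps_bind_le ?_ hrest
    exact steps_forEach_le (B := 2) _ _ _ fun _ _ => le_rfl
  · exact (steps_bind_le (a := 0) le_rfl hrest).trans (by omega)

theorem steps_initialState_le (N : Network V) : (initialState N).steps ≤
    N.verts.length + (N.verts.length * N.verts.length + ((3 * N.arcs.length + 1) +
      (N.verts.length * N.verts.length + 0))) := by
  refine steps_bind_le le_rfl fun _ => steps_bind_le le_rfl fun _ => steps_bind_le ?_ fun _ => le_rfl
  exact steps_forEach_le (B := 2) _ _ _ fun _ _ => le_rfl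

theorem steps_computeCost_le {V : Type} (N : Network V) (h : V → ℤ) (flow : V × V → ℤ) :
    (computeCost N h flow).steps ≤ 9 * N.arcs.length + 1 := by
  refine steps_forEach_le (B := 8) _ _ _ fun d e => ?_
  exact steps_bind_le (a := 1) (b := 7) le_rfl fun du =>
    steps_bind_le (a := 1) (b := 6) le_rfl fun _ => steps_ite_le le_rfl (Nat.zero_le _)

theorem steps_augment_le (s : V) (pred : V → Option V) (k : ℕ) (v : V) (st : SSPState V) :
    (augment s pred k v st).steps ≤ 8 * k := by
  induction k generalizing v st with
  | zero => exact le_rfl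
  | succ k ih =>
    rw [augment, Nat.mul_succ, Nat.add_comm]
    refine (steps_bind_le (a := 1) (b := 7 + 8 * k) le_rfl fun _ =>
      steps_ite_le (Nat.zero_le _) ?_).trans (by omega)
    refine (steps_bind_le (a := 1) (b := 6 + 8 * k) le_rfl fun p => ?_).trans (by omega)
    cases p with
    | none => exact Nat.zero_le _
    | some u =>
      have hrest : ∀ flow : V × V → ℤ, (do
          let rc ← Timed.read st.redCost (u, v)
          tick 1
          let redCost ← write st.redCost (v, u) (-rc)
          augment s pred k u ⟨st.pot, redCost, flow⟩).steps ≤ 3 + 8 * k := by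
        intro flow
        refine (steps_bind_le (a := 1) (b := 2 + 8 * k) le_rfl fun _ =>
          (steps_bind_le (a := 1) (b := 1 + 8 * k) le_rfl fun _ =>
          (steps_bind_le (a := 1) (b := 8 * k) le_rfl fun _ => ih _ _).trans (by omega)).trans
            (by omega)).trans (by omega)
      refine (steps_bind_le (a := 1) (b := 5 + 8 * k) le_rfl fun x =>
        (steps_bind_le (a := 1) (b := 4 + 8 * k) le_rfl fun _ => steps_ite_le ?_ ?_).trans
          (by omega)).trans (by omega)
      · exact (steps_bind_le (a := 1) le_rfl hrest).trans (by omega)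
      · exact (steps_bind_le (a := 1) le_rfl hrest).trans (by omega)

theorem steps_nextFlow_le (sssp : SSSPProcedure V) (N : Network V) (s t : V) (st : SSPState V) :
    (nextFlow sssp N s t st).steps ≤
      (sssp (residual N st).val s).steps + (13 * N.arcs.length + 13 * N.verts.length + 5) := by
  have h1 : (residual N st).steps ≤ 4 * N.arcs.length + 1 + 0 :=
    steps_bind_le (steps_mapEach_le (B := 2) _ _ fun _ => le_rfl) fun _ => le_rfl
  have h2 : ∀ r : SSSPResult V, (do
      let dt ← Timed.read r.dist t
      tick 1
      if dt = ⊤ then pure none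
      else do
        let pot ← updatePot N.verts r.dist st.pot
        let redCost ← updateRedCost N pot st.flow st.redCost
        let st' ← augment s r.pred N.verts.length t ⟨pot, redCost, st.flow⟩
        pure (some st')).steps ≤ 1 + (1 + ((5 * N.verts.length + 1) + ((9 * N.arcs.length + 1) +
          (8 * N.verts.length + 0)))) := by
    intro r
    refine steps_bind_le le_rfl fun dt => steps_bind_le le_rfl fun _ =>
      steps_ite_le (Nat.zero_le _) (steps_bind_le ?_ fun pot => steps_bind_le ?_ fun rc =>
        steps_bind_le (steps_augment_le _ _ _ _ _) fun _ => le_rfl)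
    · exact steps_forEach_le (B := 4) _ _ _ fun _ _ => le_rfl
    · refine steps_forEach_le (B := 8) _ _ _ fun rc e => ?_
      exact steps_bind_le (a := 1) (b := 7) le_rfl fun du =>
        steps_bind_le (a := 1) (b := 6) le_rfl fun _ =>
          steps_ite_le (le_of_eq_of_le rfl (by norm_num : 5 + 1 ≤ 6)) (Nat.zero_le _)
  -- The cost of `sssp` has no uniform bound, so it is kept at the actual residual network instead
  -- of being bounded over all inputs.
  have h3 : (nextFlow sssp N s t st).steps = (residual N st).steps +
      ((sssp (residual N st).val s).steps + _) := rfl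
  have h4 := h2 (sssp (residual N st).val s).val
  rw [h3]
  refine (Nat.add_le_add h1 (Nat.add_le_add_left h4 _)).trans ?_
  omega

end Steps

/-! ### Running time of ExactNF2 -/

namespace RPC1Instance

open NVertex

variable {D R : Type} [DecidableEq D] [DecidableEq R] {I : RPC1Instance D R}

theorem steps_flowLoop_le (sssp : SSSPProcedure (NVertex D R)) (h : NVertex D R → ℤ) (c : ℝ)
    {T k y : ℕ} {st : SSPState (NVertex D R)} (hst : I.stateAfter sssp y = some st)
    (hT : ∀ z st, z < y + k → I.stateAfter sssp z = some st →
      (sssp (residual I.reweighted st).val source).steps ≤ T) (cost : ℤ) :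
    (flowLoop sssp I.reweighted h source sink c k st cost).steps ≤
      k * (T + (22 * I.network.arcs.length + 13 * I.network.verts.length + 9)) := by
  induction k generalizing y st cost with
  | zero => exact Nat.zero_le _
  | succ k ih =>
    have h1 := steps_nextFlow_le sssp I.reweighted source sink st
    have h2 := hT y st (by omega) hst
    rw [flowLoop, Nat.succ_mul]
    simp only [↓steps_bind, steps_tick]
    rw [arcs_reweighted, verts_reweighted] at h1
    cases hnext : (nextFlow sssp I.reweighted source sink st).val with
    | none =>
      simp only [steps_pure]
      generalize k * _ = x
      omega
    | some st' =>
      have hst' : I.stateAfter sssp (y + 1) = some st' := by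
        rw [stateAfter, hst, Option.bind_some, hnext]
      have h4 := fun cost' => ih hst' (fun z st hz => hT z st (by omega)) cost'
      have h5 := steps_computeCost_le I.reweighted h st'.flow
      rw [arcs_reweighted] at h5
      have h6 := steps_bind_le h5 (f := fun cost' => do
            tick 2
            if cost < cost' ∧ -c < (cost' : ℝ) then pure st.flow
            else flowLoop sssp I.reweighted h source sink c k st' cost')
          (fun cost' => steps_bind_le (a := 2) le_rfl fun _ =>
            steps_ite_le (Nat.zero_le _) (h4 cost'))
      generalize k * _ = x at h6 ⊢
      simp only at h6 ⊢
      omega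

theorem steps_sssp_le_ssspTime (sssp : SSSPProcedure (NVertex D R)) {y : ℕ} (hy : y < I.nMin)
    {st : SSPState (NVertex D R)} (hst : I.stateAfter sssp y = some st) :
    (sssp (residual I.reweighted st).val source).steps ≤ I.ssspTime sssp := by
  have := Finset.le_sup (f := fun y => match I.stateAfter sssp y with
    | some st => (sssp (residual I.reweighted st).val source).steps
    | none => 0) (Finset.mem_range.2 hy)
  rw [hst] at this
  exact this

theorem steps_extractMatching_le {D R : Type} {I : RPC1Instance D R}
    (f : NVertex D R × NVertex D R → ℤ) : (I.extractMatching f).steps ≤ 4 * I.feasible.length + 1 := by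
  refine steps_forEach_le (B := 3) _ _ _ fun d e => ?_
  exact steps_bind_le (a := 1) (b := 2) le_rfl fun du =>
    steps_bind_le (a := 2) (b := 0) le_rfl fun _ => steps_ite_le le_rfl le_rfl

/-- The running time of ExactNF2. -/
theorem steps_exactNF2_le (sssp : SSSPProcedure (NVertex D R)) (hne : I.feasible ≠ []) (c : ℝ) :
    (I.exactNF2 sssp c).steps ≤
      200 * (I.network.verts.length * I.network.arcs.length + I.nMin * I.ssspTime sssp) := by
  obtain ⟨⟨d, r⟩, l, hl⟩ := List.exists_cons_of_ne_nil hne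
  have hdr : (d, r) ∈ I.feasible := by simp [hl]
  have hD := List.length_pos_of_mem (I.mem_drivers.2 ⟨r, hdr⟩)
  have hR := List.length_pos_of_mem (I.mem_passengers.2 ⟨d, hdr⟩)
  have hF := List.length_pos_of_mem hdr
  have hn : I.network.verts.length = I.drivers.length + I.passengers.length + 2 := by
    simp [network]
  have hm : I.network.arcs.length = I.drivers.length + I.feasible.length + I.passengers.length := by
    simp [network, add_assoc]
  have hk : I.nMin ≤ I.drivers.length := min_le_left _ _
  have hj : (johnson I.network source).val = (I.reweighted, johnsonPotential I.network source) := by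
    rw [reweighted, val_johnson]
  have hsteps : (I.exactNF2 sssp c).steps ≤ (I.network.verts.length +
      (2 * I.network.arcs.length + 0)) + ((johnson I.network source).steps +
      ((initialState I.reweighted).steps + ((9 * I.network.arcs.length + 1) +
      ((I.drivers.length + I.passengers.length + 1) +
      (I.nMin * (I.ssspTime sssp + (22 * I.network.arcs.length + 13 * I.network.verts.length + 9)) +
      ((9 * I.network.arcs.length + 1) + (2 + (4 * I.feasible.length + 1)))))))) := by
    have hcost := fun flow => steps_computeCost_le I.reweighted
      (johnsonPotential I.network source) flow
    simp only [arcs_reweighted] at hcost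
    -- The first stages are expanded at their actual values, because the bound for the main loop
    -- holds only when it starts from the true initial state.
    rw [exactNF2, steps_bind]
    refine Nat.add_le_add le_rfl ?_
    rw [show I.constructNetwork.val = I.network from rfl, steps_bind, hj]
    refine Nat.add_le_add le_rfl ?_
    simp only
    rw [steps_bind]
    refine Nat.add_le_add le_rfl ?_
    refine steps_bind_le (hcost _) fun cost => steps_bind_le le_rfl fun _ =>
      steps_bind_le ?_ fun flow => steps_bind_le (hcost _) fun cost =>
      steps_bind_le le_rfl fun _ => steps_ite_le ?_ (Nat.zero_le _)
    · refine steps_flowLoop_le sssp _ c (y := 0) rfl (fun z st hz hst => ?_) _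
      exact steps_sssp_le_ssspTime sssp (by omega) hst
    · exact steps_bind_le (b := 0) (steps_extractMatching_le flow) fun _ => le_rfl
  have h1 := steps_johnson_le I.network source
  have h2 := steps_initialState_le I.reweighted
  rw [arcs_reweighted, verts_reweighted] at h2
  have h3 : (7 * I.network.arcs.length + 2) * (I.network.verts.length - 1) ≤
      (7 * I.network.arcs.length + 2) * I.network.verts.length :=
    Nat.mul_le_mul_left _ (Nat.sub_le _ _)
  generalize (7 * I.network.arcs.length + 2) * (I.network.verts.length - 1) = x at h1 h3
  generalize I.network.verts.length = n at *
  generalize I.network.arcs.length = m at *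
  generalize I.nMin = k at *
  generalize I.ssspTime sssp = T at *
  -- Each kind of vertex and the set of matches is non-empty, so `n ≤ 2m`. With `k ≤ n` every
  -- remaining term is at most a multiple of `n * m`, and the constant `200` leaves room to spare.
  have h4 : n * n ≤ n * (2 * m) := Nat.mul_le_mul_left _ (by omega)
  have h5 : k * m ≤ n * m := Nat.mul_le_mul_right _ (by omega)
  have h6 : k * n ≤ n * n := Nat.mul_le_mul_right _ (by omega)
  have h7 : n * 1 ≤ n * m := Nat.mul_le_mul_left _ (by omega)
  have h8 : 1 * m ≤ n * m := Nat.mul_le_mul_right _ (by omega)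
  nlinarith

end RPC1Instance

end RPC

theorem mainTheorem4 :
    (∀ (V : Type) [DecidableEq V], RPC.SolvesSSSP (RPC.dijkstra (V := V))) ∧
    ∃ K : ℕ, ∀ (D R : Type) [DecidableEq D] [DecidableEq R] (I : RPC.RPC1Instance D R)
      (sssp : RPC.SSSPProcedure (RPC.NVertex D R)), RPC.SolvesSSSP sssp →
      -- exactness, for every profit target
      (∀ c : ℝ, match (I.exactNF2 sssp c).val with
        | some M => M.Nodup ∧ I.IsSolution c M.toFinset
        | none => ¬ ∃ M : Finset (D × R), I.IsMatching M ∧ c ≤ (I.totalProfit M : ℝ)) ∧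
      -- running time
      (I.feasible ≠ [] → ∀ c : ℝ, (I.exactNF2 sssp c).steps ≤
        K * (I.network.verts.length * I.network.arcs.length + I.nMin * I.ssspTime sssp)) ∧
      -- the costs of the flows do not decrease any more after the first increase
      (∀ (y z : ℕ) (f f' g : RPC.NVertex D R × RPC.NVertex D R → ℤ), y + 1 < z →
        I.IsFlowFound sssp y f → I.IsFlowFound sssp (y + 1) f' → I.IsFlowFound sssp z g →
        I.network.flowCost f < I.network.flowCost f' →
        I.network.flowCost f' ≤ I.network.flowCost g) := by
  refine ⟨fun _ _ => RPC.dijkstra_solvesSSSP, 200, fun D R _ _ I sssp hsssp => ⟨fun c => ?_,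
    fun hne => RPC.RPC1Instance.steps_exactNF2_le sssp hne, fun _ _ _ _ _ hyz hf hf' hg hlt =>
      RPC.RPC1Instance.flowCost_le_of_isFlowFound hsssp hyz hf hf' hg hlt⟩⟩
  obtain ⟨h1, h2⟩ := RPC.RPC1Instance.exactNF2_correct (I := I) hsssp c
  cases h : (I.exactNF2 sssp c).val with
  | some M => exact h1 M h
  | none => exact h2 h
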